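/- **Theorem 3.9.** Let $T>0$, let $k\ge 1$ be an integer, and let $(\omega_j)_{j\in\mathbb N}$ ($\mathbb N=\{0,1,2,\dots\}$) be a strictly increasing sequence of $[0,+\infty)$ with $\omega_0=0$ which has a polynomial asymptotic gap: there exist $\varepsilon>0$, $N_0\in\mathbb N$ and $c>0$ such that $\omega_{j+1}-\omega_j\ge c\,j^{\varepsilon}$ for all $j\ge N_0$. For $m\in\mathbb Z$ and a complex sequence $d=(d_j)_{j\in\mathbb N}$ put $$\|d\|_{h^{2m}_\omega}:=\Big(\sum_{j=0}^{+\infty}\big|(\delta_{j,0}+\omega_j^{m})\,d_j\big|^2\Big)^{1/2},$$ where for $m<0$ the weight at $j=0$ is understood to be $1$, and for $m\in\mathbb N$ let $h^{2m}_{\omega,r}(\mathbb N,\mathbb C)$ be the real normed space of all $d\in\ell^2(\mathbb N,\mathbb C)$ such that $d_0\in\mathbb R$ and $\|d\|_{h^{2m}_\omega}<+\infty$. Let $H^k_0((0,T),\mathbb R)$ be the closure of $C_c^\infty((0,T),\mathbb R)$ in the Sobolev space $H^k((0,T),\mathbb R)$. For $u\in L^1(0,T)$, define the iterated primitives $u_0:=u$,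 $u_{n+1}(t):=\int_0^t u_n(\tau)\,d\tau$. For $u\in H^k_0((0,T),\mathbb R)$ put $$\|u\|_{H^m_0(0,T)}:=\|u^{(m)}\|_{L^2(0,T)}\quad(0\le m\le k),\qquad \|u\|_{H^{-n}_0(0,T)}:=|u_1(T)|+\|u_n\|_{L^2(0,T)}\quad(n\ge1).$$ Then there exist a constant $C>0$ and a continuous ($\mathbb R$-)linear map $\mathcal M^T_k:h^{2k}_{\omega,r}(\mathbb N,\mathbb C)\to H^k_0((0,T),\mathbb R)$ such that for every $d=(d_j)_{j\in\mathbb N}\in h^{2k}_{\omega,r}(\mathbb N,\mathbb C)$ the function $u:=\mathcal M^T_k(d)$ satisfies the moment problem $$\int_0^T u(t)e^{i\omega_j t}\,dt=d_j,\qquad\forall j\in\mathbb N,$$ the boundary conditions $$u_2(T)=u_3(T)=\dots=u_{k+1}(T)=0,$$ and the estimates $$\|u\|_{H^m_0(0,T)}\le C\,\|d\|_{h^{2m}_\omega},\qquad\forall m=-(k+1),\dots,0,\dots,k.$$ -/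

import Mathlib

open MeasureTheory Set

open scoped ENNReal

noncomputable section

namespace MomentProblem

/-! ### Frequencies and weighted sequence spaces -/

/-- Polynomial asymptotic gap. -/
def AsymptGapPoly (ω : ℕ → ℝ) : Prop :=
  ∃ ε : ℝ, 0 < ε ∧ ∃ N₀ : ℕ, ∃ c : ℝ, 0 < c ∧
    ∀ j : ℕ, N₀ ≤ j → c * (j : ℝ) ^ ε ≤ ω (j + 1) - ω j

/-- The weight `δ_{j,0} + ω_j ^ m`, for an integer `m` of either sign. When `m < 0` and `ω_0 = 0`
the term `ω_0 ^ m` is `0` (as in Mathlib), so that the weight at `j = 0` is `1`. -/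
def hWeight (ω : ℕ → ℝ) (m : ℤ) (j : ℕ) : ℝ := (if j = 0 then 1 else 0) + ω j ^ m

/-- `‖d‖_{h^{2m}_ω} = (∑_j |(δ_{j,0} + ω_j ^ m) d_j|²)^{1/2}`. -/
def hNorm (ω : ℕ → ℝ) (m : ℤ) (d : ℕ → ℂ) : ℝ :=
  Real.sqrt (∑' j, ‖(hWeight ω m j : ℂ) * d j‖ ^ 2)

/-- The real vector space of the sequences `d ∈ ℓ²(ℕ, ℂ)` with `d_0 ∈ ℝ` and
`∑_j |(δ_{j,0} + ω_j ^ m) d_j|² < ∞`. -/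
def hSubmodule (ω : ℕ → ℝ) (m : ℕ) : Submodule ℝ (ℕ → ℂ) where
  carrier := {d | (d 0).im = 0 ∧ Memℓp d 2 ∧ Memℓp (fun j => (hWeight ω m j : ℂ) * d j) 2}
  zero_mem' := by
    refine ⟨by simp, zero_memℓp, ?_⟩
    have h : (fun j => (hWeight ω m j : ℂ) * (0 : ℕ → ℂ) j) = 0 := by
      funext j
      simp
    rw [h]
    exact zero_memℓp
  add_mem' := by
    rintro a b ⟨ha, ha1, ha2⟩ ⟨hb, hb1, hb2⟩
    refine ⟨by simp [ha, hb], ha1.add hb1, ?_⟩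
    have h := ha2.add hb2
    convert h using 1
    funext j
    simp [mul_add]
  smul_mem' := by
    rintro r a ⟨ha, ha1, ha2⟩
    refine ⟨by simp [ha], ha1.const_smul r, ?_⟩
    have h := ha2.const_smul r
    convert h using 1
    funext j
    simp only [Pi.smul_apply, Complex.real_smul]
    ring

/-- The space `h^{2m}_{ω,r}(ℕ, ℂ)`. It is a copy of `hSubmodule ω m`, so that its topology is the
one of the norm `‖·‖_{h^{2m}_ω}` and not the product topology of `ℕ → ℂ`. -/
def HSeq (ω : ℕ → ℝ) (m : ℕ) : Type := hSubmodule ω m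

namespace HSeq

variable {ω : ℕ → ℝ} {m : ℕ}

instance : AddCommGroup (HSeq ω m) := inferInstanceAs (AddCommGroup (hSubmodule ω m))

instance : Module ℝ (HSeq ω m) := inferInstanceAs (Module ℝ (hSubmodule ω m))

/-- The underlying sequence. -/
def seq (d : HSeq ω m) : ℕ → ℂ := (show hSubmodule ω m from d).1

theorem seq_mem (d : HSeq ω m) : d.seq ∈ hSubmodule ω m :=
  (show hSubmodule ω m from d).2

/-- Multiplication by the weight, with values in `ℓ²`. -/
def toLp : HSeq ω m →ₗ[ℝ] lp (fun _ : ℕ => ℂ) 2 where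
  toFun d := ⟨fun j => (hWeight ω m j : ℂ) * d.seq j, d.seq_mem.2.2⟩
  map_add' a b := by
    ext j
    exact mul_add _ _ _
  map_smul' r a := by
    ext j
    change (hWeight ω m j : ℂ) * (r • a.seq j) = r • ((hWeight ω m j : ℂ) * a.seq j)
    simp only [Complex.real_smul]
    ring

/-- The norm `‖·‖_{h^{2m}_ω}` (see `HSeq.norm_eq`). For an arbitrary sequence `ω` this is a
seminorm; it is a norm as soon as `ω_0 = 0` and `ω_j > 0` for `j ≥ 1` (see `HSeq.eq_zero`). -/
instance : SeminormedAddCommGroup (HSeq ω m) :=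
  SeminormedAddCommGroup.induced (HSeq ω m) (lp (fun _ : ℕ => ℂ) 2) toLp

instance : NormedSpace ℝ (HSeq ω m) :=
  NormedSpace.induced ℝ (HSeq ω m) (lp (fun _ : ℕ => ℂ) 2) toLp

theorem norm_eq (d : HSeq ω m) : ‖d‖ = hNorm ω m d.seq := by
  change ‖toLp d‖ = _
  rw [lp.norm_eq_tsum_rpow (by norm_num), hNorm, Real.sqrt_eq_rpow]
  simp [toLp]

theorem eq_zero (h0 : ω 0 = 0) (hpos : ∀ j, j ≠ 0 → 0 < ω j) (d : HSeq ω m) (hd : ‖d‖ = 0) :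
    d = 0 := by
  have h1 : toLp d = 0 := norm_eq_zero.mp hd
  apply Subtype.ext
  funext j
  have h2 : (hWeight ω m j : ℂ) * d.seq j = 0 :=
    congrFun (congrArg (fun x : lp (fun _ : ℕ => ℂ) 2 => (x : ℕ → ℂ)) h1) j
  have h3 : hWeight ω m j ≠ 0 := by
    unfold hWeight
    by_cases hj : j = 0
    · subst hj
      rcases Nat.eq_zero_or_pos m with hm | hm
      · subst hm; simp
      · simp [h0, hm.ne']
    · simpa [hj] using fun h => absurd h (hpos j hj).ne'
  exact (mul_eq_zero.mp h2).resolve_left (by exact_mod_cast h3)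

/-- On `h^{2k}_{ω,r}`, the series that defines `‖·‖_{h^{2m}_ω}` converges for every integer
`m ≤ k`, of either sign. -/
theorem summable {k : ℕ} (hω : StrictMono ω) (h0 : ω 0 = 0) (d : HSeq ω k) {m : ℤ}
    (hm : m ≤ k) : Summable (fun j => ‖(hWeight ω m j : ℂ) * d.seq j‖ ^ 2) := by
  have hs : ∀ f : ℕ → ℂ, Memℓp f 2 → Summable (fun j => ‖f j‖ ^ 2) := by
    intro f hf
    simpa using hf.summable (by norm_num)
  have hk := hs _ d.seq_mem.2.2
  rw [← summable_nat_add_iff 1] at hk ⊢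
  have h1 : 0 < ω 1 := h0 ▸ hω one_pos
  refine Summable.of_nonneg_of_le (fun _ => by positivity) (fun j => ?_)
    (hk.mul_left ((ω 1 ^ (m - k)) ^ 2))
  have hj : ω 1 ≤ ω (j + 1) := hω.monotone (by omega)
  have hj0 : 0 < ω (j + 1) := h1.trans_le hj
  have hz : ω (j + 1) ^ (m - k) ≤ ω 1 ^ (m - k) := by
    have e : m - k = -((k - m).toNat : ℤ) := by omega
    rw [e, zpow_neg, zpow_neg, zpow_natCast, zpow_natCast]
    gcongr
  have hw : ω (j + 1) ^ m = ω (j + 1) ^ (m - k) * ω (j + 1) ^ (k : ℤ) := by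
    rw [← zpow_add₀ hj0.ne']
    congr 1
    ring
  rw [← mul_pow]
  gcongr
  simp only [hWeight, Nat.succ_ne_zero, if_false, zero_add, norm_mul, Complex.norm_real,
    Real.norm_eq_abs, abs_of_pos (zpow_pos hj0 _)]
  rw [hw, ← mul_assoc]
  gcongr

end HSeq

/-! ### Sobolev spaces on `(0, T)` -/

/-- Lebesgue measure on `(0, T)`. -/
abbrev μI (T : ℝ) : Measure ℝ := volume.restrict (Ioo 0 T)

/-- The real Hilbert space `L²((0, T), ℝ)`. -/
abbrev L2 (T : ℝ) : Type := Lp ℝ 2 (μI T)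

/-- `φ ∈ C_c^∞((0, T), ℝ)`. -/
structure IsTest (T : ℝ) (φ : ℝ → ℝ) : Prop where
  smooth : ContDiff ℝ ((⊤ : ℕ∞) : WithTop ℕ∞) φ
  compact : HasCompactSupport φ
  supp : tsupport φ ⊆ Ioo 0 T

theorem IsTest.add {T : ℝ} {φ ψ : ℝ → ℝ} (hφ : IsTest T φ) (hψ : IsTest T ψ) :
    IsTest T (φ + ψ) :=
  ⟨hφ.smooth.add hψ.smooth, hφ.compact.add hψ.compact,
    (tsupport_add φ ψ).trans (union_subset hφ.supp hψ.supp)⟩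

theorem IsTest.smul {T : ℝ} {φ : ℝ → ℝ} (r : ℝ) (hφ : IsTest T φ) : IsTest T (r • φ) := by
  have h : r • φ = (fun _ : ℝ => r) • φ := rfl
  refine ⟨hφ.smooth.const_smul r, ?_, ?_⟩
  · rw [h]
    exact hφ.compact.smul_left
  · rw [h]
    exact (tsupport_smul_subset_right (fun _ : ℝ => r) φ).trans hφ.supp

theorem IsTest.zero (T : ℝ) : IsTest T 0 :=
  ⟨contDiff_const, HasCompactSupport.zero, by simp [tsupport]⟩

theorem IsTest.memLp_iteratedDeriv {T : ℝ} {φ : ℝ → ℝ} (hφ : IsTest T φ) (n : ℕ) :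
    MemLp (iteratedDeriv n φ) 2 (μI T) := by
  have hc : Continuous (iteratedDeriv n φ) :=
    hφ.smooth.continuous_iteratedDeriv n (by exact_mod_cast le_top)
  have hs : HasCompactSupport (iteratedDeriv n φ) := by
    induction n with
    | zero => simpa using hφ.compact
    | succ n ih =>
      rw [iteratedDeriv_succ]
      exact (ih (hφ.smooth.continuous_iteratedDeriv n (by exact_mod_cast le_top))).deriv
  exact (hc.memLp_of_hasCompactSupport hs).restrict _

theorem IsTest.integrable_mul {T : ℝ} {φ : ℝ → ℝ} (hφ : IsTest T φ) (n : ℕ) (u : L2 T) :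
    Integrable (fun t => u t * iteratedDeriv n φ t) (μI T) :=
  (Lp.memLp u).integrable_mul (hφ.memLp_iteratedDeriv n)

/-- `v ∈ L²(0, T)` is the `n`-th weak derivative of `u ∈ L²(0, T)` on `(0, T)`. -/
def IsWeakDeriv (T : ℝ) (n : ℕ) (u v : L2 T) : Prop :=
  ∀ φ : ℝ → ℝ, IsTest T φ →
    ∫ t in Ioo 0 T, u t * iteratedDeriv n φ t = (-1) ^ n * ∫ t in Ioo 0 T, v t * φ t

theorem IsWeakDeriv.add {T : ℝ} {n : ℕ} {u v u' v' : L2 T} (h : IsWeakDeriv T n u v)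
    (h' : IsWeakDeriv T n u' v') : IsWeakDeriv T n (u + u') (v + v') := by
  intro φ hφ
  have e1 : ∫ t in Ioo 0 T, (u + u' : L2 T) t * iteratedDeriv n φ t =
      ∫ t in Ioo 0 T, (u t * iteratedDeriv n φ t + u' t * iteratedDeriv n φ t) := by
    apply integral_congr_ae
    filter_upwards [Lp.coeFn_add u u'] with t ht
    rw [ht, Pi.add_apply, add_mul]
  have e2 : ∫ t in Ioo 0 T, (v + v' : L2 T) t * φ t =
      ∫ t in Ioo 0 T, (v t * φ t + v' t * φ t) := by
    apply integral_congr_ae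
    filter_upwards [Lp.coeFn_add v v'] with t ht
    rw [ht, Pi.add_apply, add_mul]
  have i1 := hφ.integrable_mul 0 v
  have i2 := hφ.integrable_mul 0 v'
  rw [iteratedDeriv_zero] at i1 i2
  rw [e1, e2, integral_add (hφ.integrable_mul n u) (hφ.integrable_mul n u'), integral_add i1 i2,
    h φ hφ, h' φ hφ, mul_add]

theorem IsWeakDeriv.smul {T : ℝ} {n : ℕ} {u v : L2 T} (r : ℝ) (h : IsWeakDeriv T n u v) :
    IsWeakDeriv T n (r • u) (r • v) := by
  intro φ hφ
  have e1 : ∫ t in Ioo 0 T, (r • u : L2 T) t * iteratedDeriv n φ t =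
      ∫ t in Ioo 0 T, r * (u t * iteratedDeriv n φ t) := by
    apply integral_congr_ae
    filter_upwards [Lp.coeFn_smul r u] with t ht
    rw [ht, Pi.smul_apply, smul_eq_mul, mul_assoc]
  have e2 : ∫ t in Ioo 0 T, (r • v : L2 T) t * φ t = ∫ t in Ioo 0 T, r * (v t * φ t) := by
    apply integral_congr_ae
    filter_upwards [Lp.coeFn_smul r v] with t ht
    rw [ht, Pi.smul_apply, smul_eq_mul, mul_assoc]
  rw [e1, e2, integral_const_mul, integral_const_mul, h φ hφ]
  ring

theorem IsWeakDeriv.zero (T : ℝ) (n : ℕ) : IsWeakDeriv T n 0 0 := by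
  have h : IsWeakDeriv T n ((0 : ℝ) • (0 : L2 T)) ((0 : ℝ) • (0 : L2 T)) := by
    intro φ hφ
    have e : ∀ ψ : ℝ → ℝ, ∫ t in Ioo 0 T, ((0 : ℝ) • (0 : L2 T) : L2 T) t * ψ t = 0 := by
      intro ψ
      rw [smul_zero]
      apply integral_eq_zero_of_ae
      filter_upwards [Lp.coeFn_zero ℝ 2 (μI T)] with t ht
      rw [ht]
      simp
    rw [e, e, mul_zero]
  simpa using h

/-- The Sobolev space `H^k((0, T), ℝ)`. An element is the tuple `(u, u', …, u^{(k)})` of an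
`L²` function and its weak derivatives of order at most `k`, all in `L²` (they are determined by
`u`). The norm, inherited from the `ℓ²`-sum of `k + 1` copies of `L²`, is the usual one,
`(∑_{n ≤ k} ‖u^{(n)}‖²_{L²})^{1/2}`. -/
def SobolevH (k : ℕ) (T : ℝ) : Submodule ℝ (PiLp 2 (fun _ : Fin (k + 1) => L2 T)) where
  carrier := {U | ∀ n : Fin (k + 1), IsWeakDeriv T n (U 0) (U n)}
  zero_mem' := fun n => IsWeakDeriv.zero T n
  add_mem' := fun ha hb n => (ha n).add (hb n)
  smul_mem' := fun r _ ha n => (ha n).smul r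

/-- The elements of `H^k(0, T)` that are (almost everywhere equal to) test functions. -/
def testSubmodule (k : ℕ) (T : ℝ) : Submodule ℝ (SobolevH k T) where
  carrier := {U | ∃ φ : ℝ → ℝ, IsTest T φ ∧ U.1 0 =ᵐ[μI T] φ}
  zero_mem' := ⟨0, IsTest.zero T, Lp.coeFn_zero ℝ 2 (μI T)⟩
  add_mem' := by
    rintro a b ⟨φ, hφ, ha⟩ ⟨ψ, hψ, hb⟩
    exact ⟨φ + ψ, hφ.add hψ, (Lp.coeFn_add (a.1 0) (b.1 0)).trans (ha.add hb)⟩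
  smul_mem' := by
    rintro r a ⟨φ, hφ, ha⟩
    refine ⟨r • φ, hφ.smul r, (Lp.coeFn_smul r (a.1 0)).trans ?_⟩
    filter_upwards [ha] with t ht
    simp [ht]

/-- `H^k_0((0, T), ℝ)`: the closure of `C_c^∞(0, T)` in `H^k(0, T)`. Its topology is that of the
`H^k` norm or, equivalently by the Poincaré inequality, of the norm `‖u^{(k)}‖_{L²}`. -/
def SobolevH0 (k : ℕ) (T : ℝ) : Submodule ℝ (SobolevH k T) :=
  (testSubmodule k T).topologicalClosure

/-- The weak derivative `u^{(n)} ∈ L²(0, T)`, `0 ≤ n ≤ k`, of `u ∈ H^k_0(0, T)`. For `n = 0` this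
is `u` itself. -/
def SobolevH0.wderiv {k : ℕ} {T : ℝ} (u : SobolevH0 k T) (n : Fin (k + 1)) : L2 T := u.1.1 n

/-- The function `u : (0, T) → ℝ` underlying an element of `H^k_0(0, T)`. -/
def SobolevH0.toFun {k : ℕ} {T : ℝ} (u : SobolevH0 k T) : ℝ → ℝ := SobolevH0.wderiv u 0

/-- For `0 ≤ m ≤ k`, the norm `‖u‖_{H^m_0(0, T)} = (∫₀ᵀ u^{(m)}(t)² dt)^{1/2}`. -/
def SobolevH0.posNorm {k : ℕ} {T : ℝ} (u : SobolevH0 k T) (m : Fin (k + 1)) : ℝ :=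
  ‖SobolevH0.wderiv u m‖

/-! ### Iterated primitives and negative norms -/

/-- The iterated primitives `u_0 = u`, `u_{n+1}(t) = ∫₀ᵗ u_n(τ) dτ`. -/
def iterPrim (u : ℝ → ℝ) : ℕ → ℝ → ℝ
  | 0 => u
  | n + 1 => fun t => ∫ τ in (0 : ℝ)..t, iterPrim u n τ

/-- For `n ≥ 1`, the norm `‖u‖_{H^{-n}(0, T)} = |u_1(T)| + ‖u_n‖_{L²(0, T)}`. -/
def negNorm (T : ℝ) (n : ℕ) (u : ℝ → ℝ) : ℝ :=
  |iterPrim u 1 T| + Real.sqrt (∫ t in (0 : ℝ)..T, (iterPrim u n t) ^ 2)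

end MomentProblem

end

/-!
Let `σ` be a real test function on `(0, T)` with `∫ σ² = 1`, let `ρ = σ²`, and let `λ` run over the
two-sided frequencies `±ω_j`, `j ≥ 1`. For a superposition of the modes `ρ(t) e^{-iλ_j t}` the
moment problem is a linear system with matrix `ρ̂(λ_l - λ_j) = 1 + A`. Since `ρ̂` decays fast and
the frequencies are separated, `A` and its conjugates by the powers of `λ` are absolutely summable,
hence compact on `ℓ²`, and by the Fredholm alternative it is enough that `1 + A` is injective.
A kernel vector `x` gives a relation `∑ x_j σ(t) e^{-iλ_j t} = 0`; pairing it with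
`2σ'(t) e^{-iλ_l t}` shows that the finite-dimensional kernel is stable under multiplication by `λ`.
A nonzero kernel would then contain a basis vector, contradicting `∫ σ² = 1`. Invertibility of all
the conjugates gives the estimates on the whole Sobolev scale at once. Real parts of `(k + 1)`-st
derivatives of such superpositions solve the problem for `d_0 = 0`, with iterated primitives that
vanish at `T`; the zero frequency is corrected by a multiple of one fixed function.
-/

noncomputable section

namespace MomentProblem

open Filter Topology

/-! ### Absolutely summable matrices and diagonal operators on `ℓ²` -/

section Operators

theorem isUnit_one_add_of_isCompactOperator {X : Type*} [NormedAddCommGroup X] [NormedSpace ℂ X]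
    [CompleteSpace X] {K : X →L[ℂ] X} (hK : IsCompactOperator K)
    (hinj : ∀ x, (1 + K) x = 0 → x = 0) : IsUnit (1 + K) := by
  rcases hK.hasEigenvalue_or_mem_resolventSet (μ := (-1 : ℂ)) (by norm_num) with h | h
  · obtain ⟨x, hx, hx0⟩ := h.exists_hasEigenvector
    refine absurd (hinj x ?_) hx0
    have hKx : K x = -x := by simpa using Module.End.mem_eigenspace_iff.mp hx
    simp [hKx]
  · rw [spectrum.mem_resolventSet_iff, map_neg, map_one, ← IsUnit.neg_iff] at h
    convert h using 1
    abel

/-- The complex Hilbert space `ℓ²(ι, ℂ)`. -/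
abbrev Ell2 (ι : Type*) : Type _ := lp (fun _ : ι => ℂ) 2

variable {ι : Type*}

/-- The diagonal operator on `ℓ²` with bounded coefficients `c`. -/
def diagOp (c : ι → ℂ) (hc : BddAbove (range fun i => ‖c i‖)) : Ell2 ι →L[ℂ] Ell2 ι :=
  lp.mapCLM 2 (fun i => ContinuousLinearMap.mul ℂ ℂ (c i)) (le_max_right hc.some 0) fun i =>
    (ContinuousLinearMap.opNorm_mul_apply_le ℂ ℂ (c i)).trans
      ((hc.some_mem ⟨i, rfl⟩).trans (le_max_left _ _))

@[simp]
theorem diagOp_apply (c : ι → ℂ) (hc : BddAbove (range fun i => ‖c i‖)) (x : Ell2 ι) (i : ι) :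
    diagOp c hc x i = c i * x i := rfl

theorem diagOp_pow_apply (c : ι → ℂ) (hc : BddAbove (range fun i => ‖c i‖)) (n : ℕ)
    (x : Ell2 ι) (i : ι) : (diagOp c hc ^ n) x i = c i ^ n * x i := by
  induction n with
  | zero => simp
  | succ n ih => rw [pow_succ', mul_apply_eq_comp, diagOp_apply, ih, pow_succ', mul_assoc]

theorem diagOp_injective {c : ι → ℂ} (hc : BddAbove (range fun i => ‖c i‖)) (h0 : ∀ i, c i ≠ 0) :
    Function.Injective (diagOp c hc) := by
  refine (injective_iff_map_eq_zero _).mpr fun x hx => ?_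
  ext i
  have hi : c i * x i = 0 := by rw [← diagOp_apply c hc, hx]; rfl
  exact (mul_eq_zero.mp hi).resolve_left (h0 i)

variable [DecidableEq ι]

/-- The rank one operator `x ↦ x_j δ_i`. -/
def unitOp (i j : ι) : Ell2 ι →L[ℂ] Ell2 ι :=
  (lp.singleContinuousLinearMap ℂ (fun _ : ι => ℂ) 2 i).comp (lp.evalCLM ℂ (fun _ : ι => ℂ) 2 j)

theorem unitOp_apply (i j : ι) (x : Ell2 ι) : unitOp i j x = lp.single 2 i (x j) := rfl

theorem norm_unitOp_le (i j : ι) : ‖unitOp i j‖ ≤ 1 := by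
  refine ContinuousLinearMap.opNorm_le_bound _ zero_le_one fun x => ?_
  rw [unitOp_apply, lp.norm_single two_pos, one_mul]
  exact lp.norm_apply_le_norm two_ne_zero x j

theorem isCompactOperator_unitOp (i j : ι) : IsCompactOperator (unitOp i j) :=
  (isCompactOperator_of_locallyCompactSpace_rng
    (lp.singleContinuousLinearMap ℂ (fun _ : ι => ℂ) 2 i)).comp_clm
    (lp.evalCLM ℂ (fun _ : ι => ℂ) 2 j)

/-- The operator on `ℓ²` with matrix `A`, for `A` absolutely summable. -/
def matOp (A : ι → ι → ℂ) : Ell2 ι →L[ℂ] Ell2 ι :=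
  ∑' p : ι × ι, A p.1 p.2 • unitOp p.1 p.2

variable {A B : ι → ι → ℂ}

theorem norm_smul_unitOp_le (a : ℂ) (i j : ι) : ‖a • unitOp i j‖ ≤ ‖a‖ := by
  rw [norm_smul]
  exact mul_le_of_le_one_right (norm_nonneg _) (norm_unitOp_le i j)

theorem hasSum_matOp (hA : Summable fun p : ι × ι => ‖A p.1 p.2‖) :
    HasSum (fun p : ι × ι => A p.1 p.2 • unitOp p.1 p.2) (matOp A) :=
  (Summable.of_norm_bounded hA fun _ => norm_smul_unitOp_le _ _ _).hasSum

theorem norm_matOp_le (hA : Summable fun p : ι × ι => ‖A p.1 p.2‖) :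
    ‖matOp A‖ ≤ ∑' p : ι × ι, ‖A p.1 p.2‖ :=
  tsum_of_norm_bounded hA.hasSum fun _ => norm_smul_unitOp_le _ _ _

theorem isCompactOperator_matOp (hA : Summable fun p : ι × ι => ‖A p.1 p.2‖) :
    IsCompactOperator (matOp A) := by
  refine isCompactOperator_of_tendsto (hasSum_matOp hA) (Eventually.of_forall fun s => ?_)
  change (∑ p ∈ s, A p.1 p.2 • unitOp p.1 p.2) ∈ compactOperator (RingHom.id ℂ) (Ell2 ι) (Ell2 ι)
  exact Submodule.sum_mem _ fun p _ => Submodule.smul_mem _ _ (isCompactOperator_unitOp p.1 p.2)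

theorem hasSum_matOp_apply (hA : Summable fun p : ι × ι => ‖A p.1 p.2‖) (x : Ell2 ι) (l : ι) :
    HasSum (fun j => A l j * x j) (matOp A x l) := by
  let ev : (Ell2 ι →L[ℂ] Ell2 ι) →L[ℂ] ℂ :=
    (lp.evalCLM ℂ (fun _ : ι => ℂ) 2 l).comp (ContinuousLinearMap.apply ℂ (Ell2 ι) x)
  have hev : ∀ p : ι × ι, ev (A p.1 p.2 • unitOp p.1 p.2) =
      if p.1 = l then A l p.2 * x p.2 else 0 := by
    rintro ⟨i, j⟩
    change (A i j • lp.single 2 i (x j) : Ell2 ι) l = _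
    rcases eq_or_ne i l with rfl | hi
    · simp
    · simp [hi, hi.symm]
  have hsum := (hasSum_matOp hA).mapL ev
  simp only [hev] at hsum
  have hinj : Function.Injective (Prod.mk l : ι → ι × ι) := Prod.mk_right_injective l
  rw [← hinj.hasSum_iff] at hsum
  · simpa [Function.comp_def] using! hsum
  · rintro ⟨i, j⟩ hij
    exact if_neg fun h => hij ⟨j, by rw [← h]⟩

theorem matOp_mul_diagOp (hA : Summable fun p : ι × ι => ‖A p.1 p.2‖)
    (hB : Summable fun p : ι × ι => ‖B p.1 p.2‖) {c : ι → ℂ}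
    (hc : BddAbove (range fun i => ‖c i‖)) (hAB : ∀ l j, A l j * c j = c l * B l j) :
    matOp A * diagOp c hc = diagOp c hc * matOp B := by
  ext x l
  refine (hasSum_matOp_apply hA (diagOp c hc x) l).unique ?_
  refine ((hasSum_matOp_apply hB x l).mul_left (c l)).congr_fun fun j => ?_
  rw [diagOp_apply, ← mul_assoc, hAB, mul_assoc]

/-- The matrix `A` with the rows in `F` replaced by zero. -/
def offRows (F : Finset ι) (A : ι → ι → ℂ) (l j : ι) : ℂ := if l ∈ F then 0 else A l j

theorem norm_offRows_le (F : Finset ι) (A : ι → ι → ℂ) (l j : ι) :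
    ‖offRows F A l j‖ ≤ ‖A l j‖ := by
  unfold offRows
  split_ifs <;> simp

theorem summable_offRows (hA : Summable fun p : ι × ι => ‖A p.1 p.2‖) (F : Finset ι) :
    Summable fun p : ι × ι => ‖offRows F A p.1 p.2‖ :=
  hA.of_nonneg_of_le (fun _ => norm_nonneg _) fun _ => norm_offRows_le _ _ _ _

theorem tendsto_matOp_offRows (hA : Summable fun p : ι × ι => ‖A p.1 p.2‖) :
    Tendsto (fun F => matOp (offRows F A)) atTop (𝓝 0) := by
  have h := tendsto_tsum_of_dominated_convergence (𝓕 := atTop)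
    (f := fun F (p : ι × ι) => ‖offRows F A p.1 p.2‖) (g := fun _ => 0) hA
    (fun p => tendsto_const_nhds.congr' ?_) (Eventually.of_forall fun F p => ?_)
  · rw [tsum_zero] at h
    exact squeeze_zero_norm (fun F => norm_matOp_le (summable_offRows hA F)) h
  · filter_upwards [eventually_ge_atTop {p.1}] with F hF
    simp [offRows, Finset.singleton_subset_iff.mp hF]
  · rw [norm_norm]
    exact norm_offRows_le _ _ _ _

theorem eventually_isUnit_one_add_matOp_offRows (hA : Summable fun p : ι × ι => ‖A p.1 p.2‖) :
    ∀ᶠ F in atTop, IsUnit (1 + matOp (offRows F A)) := by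
  have hlim := (tendsto_matOp_offRows hA).norm
  rw [norm_zero] at hlim
  filter_upwards [hlim.eventually_lt_const one_pos] with F hF
  simpa using isUnit_one_sub_of_norm_lt_one (x := -matOp (offRows F A)) (by rwa [norm_neg])

theorem matOp_offRows_apply (hA : Summable fun p : ι × ι => ‖A p.1 p.2‖) (F : Finset ι)
    (x : Ell2 ι) (l : ι) : matOp (offRows F A) x l = if l ∈ F then 0 else matOp A x l := by
  refine (hasSum_matOp_apply (summable_offRows hA F) x l).unique ?_
  by_cases hl : l ∈ F
  · simp [offRows, hl]
  · simpa [offRows, hl] using hasSum_matOp_apply hA x l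

/-- Regularity of the kernel. Removing finitely many rows makes both `A` and its conjugate `B` of
norm less than `1`, while it only adds a finitely supported right-hand side to `x + A x = 0`. The
conjugate equation is then solvable, and its solution is carried to `x` by `diagOp c`. -/
theorem ker_one_add_matOp_le_range_diagOp (hA : Summable fun p : ι × ι => ‖A p.1 p.2‖)
    (hB : Summable fun p : ι × ι => ‖B p.1 p.2‖) {c : ι → ℂ}
    (hc : BddAbove (range fun i => ‖c i‖)) (hc0 : ∀ i, c i ≠ 0)
    (hAB : ∀ l j, A l j * c j = c l * B l j) {x : Ell2 ι} (hx : (1 + matOp A) x = 0) :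
    ∃ z, diagOp c hc z = x := by
  obtain ⟨F, hFA, hFB⟩ := ((eventually_isUnit_one_add_matOp_offRows hA).and
    (eventually_isUnit_one_add_matOp_offRows hB)).exists
  let f : Ell2 ι := ∑ l ∈ F, lp.single 2 l ((c l)⁻¹ * x l)
  have hf : (1 + matOp (offRows F A)) x = diagOp c hc f := by
    ext l
    have hl : x l + matOp A x l = 0 := congrArg (fun y : Ell2 ι => y l) hx
    have hfl : f l = if l ∈ F then (c l)⁻¹ * x l else 0 := by
      refine (map_sum (lp.evalCLM ℂ (fun _ : ι => ℂ) 2 l) _ F).trans ?_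
      change ∑ i ∈ F, (lp.single 2 i ((c i)⁻¹ * x i) : Ell2 ι) l = _
      simp [Pi.single_apply]
    change x l + matOp (offRows F A) x l = c l * f l
    rw [matOp_offRows_apply hA, hfl]
    split_ifs
    · rw [add_zero, mul_inv_cancel_left₀ (hc0 l)]
    · rw [hl, mul_zero]
  obtain ⟨z, hz⟩ := (ContinuousLinearMap.isUnit_iff_bijective.mp hFB).2 f
  refine ⟨z, (ContinuousLinearMap.isUnit_iff_bijective.mp hFA).1 ?_⟩
  have hcomm := matOp_mul_diagOp (summable_offRows hA F) (summable_offRows hB F) hc fun l j => by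
    unfold offRows
    split_ifs
    · simp
    · exact hAB l j
  have hcommz : matOp (offRows F A) (diagOp c hc z) = diagOp c hc (matOp (offRows F B) z) :=
    congrArg (fun K : Ell2 ι →L[ℂ] Ell2 ι => K z) hcomm
  rw [hf, ← hz]
  simp [hcommz]

/-- An injective diagonal operator with distinct coefficients which maps onto a nonzero
finite-dimensional space of sequences has an eigenvector there, supported at a single index. -/
theorem exists_single_mem_of_le_map_diagOp {c : ι → ℂ} (hc : BddAbove (range fun i => ‖c i‖))
    (hc0 : ∀ i, c i ≠ 0) (hinj : Function.Injective c) {N : Submodule ℂ (Ell2 ι)}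
    [FiniteDimensional ℂ N] (hN : N ≤ N.map (diagOp c hc).toLinearMap) (hN0 : N ≠ ⊥) :
    ∃ i, lp.single 2 i (1 : ℂ) ∈ N := by
  set D := (diagOp c hc).toLinearMap
  have hmap : N = N.map D := Submodule.eq_of_le_of_finrank_eq hN
    (Submodule.equivMapOfInjective D (diagOp_injective hc hc0) N).finrank_eq
  have hD : ∀ x ∈ N, D x ∈ N := fun x hx => hmap ▸ Submodule.mem_map_of_mem hx
  have : Nontrivial N := Submodule.nontrivial_iff_ne_bot.mpr hN0
  obtain ⟨μ, hμ⟩ := Module.End.exists_eigenvalue (D.restrict hD)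
  obtain ⟨⟨x, hxN⟩, hx, hx0⟩ := hμ.exists_hasEigenvector
  have hcx : ∀ j, c j * x j = μ * x j := fun j =>
    congrArg (fun y : N => (y : Ell2 ι) j) (Module.End.mem_eigenspace_iff.mp hx)
  obtain ⟨i, hi⟩ : ∃ i, x i ≠ 0 := by
    by_contra! h
    exact hx0 (Subtype.ext (lp.ext (funext h)))
  have hxi : ∀ j, j ≠ i → x j = 0 := fun j hj => by
    have hμi : c i = μ := mul_right_cancel₀ hi (hcx i)
    by_contra hxj
    exact hj (hinj ((mul_right_cancel₀ hxj (hcx j)).trans hμi.symm))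
  refine ⟨i, ?_⟩
  convert N.smul_mem (x i)⁻¹ hxN using 1
  ext j
  rcases eq_or_ne j i with rfl | hj
  · simp [hi]
  · simp [hj, hxi j hj]

end Operators

/-! ### Bessel families -/

section Bessel

variable {ι : Type*} {H : Type*} [NormedAddCommGroup H] [InnerProductSpace ℂ H] {g h : ι → H}

/-- A Bessel family: the synthesis `x ↦ ∑ x_i g_i` is defined and bounded on `ℓ²`. -/
def IsBessel (g : ι → H) : Prop :=
  ∃ S : Ell2 ι →L[ℂ] H, ∀ x : Ell2 ι, HasSum (fun i => x i • g i) (S x)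

namespace IsBessel

/-- The synthesis operator `x ↦ ∑ x_i g_i` of a Bessel family. -/
def synthesis (hg : IsBessel g) : Ell2 ι →L[ℂ] H := hg.choose

theorem hasSum_synthesis (hg : IsBessel g) (x : Ell2 ι) :
    HasSum (fun i => x i • g i) (hg.synthesis x) := hg.choose_spec x

theorem add (hg : IsBessel g) (hh : IsBessel h) : IsBessel fun i => g i + h i :=
  ⟨hg.synthesis + hh.synthesis, fun x => by
    simpa [smul_add] using (hg.hasSum_synthesis x).add (hh.hasSum_synthesis x)⟩

theorem smul (hg : IsBessel g) {c : ι → ℂ} (hc : BddAbove (range fun i => ‖c i‖)) :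
    IsBessel fun i => c i • g i :=
  ⟨hg.synthesis.comp (diagOp c hc), fun x => by
    simpa [smul_smul, mul_comm] using hg.hasSum_synthesis (diagOp c hc x)⟩

end IsBessel

theorem Ell2.hasSum_norm_sq (x : Ell2 ι) : HasSum (fun i => ‖x i‖ ^ 2) (‖x‖ ^ 2) := by
  simpa using lp.hasSum_norm (p := 2) (by norm_num) x

theorem summable_smul_of_norm_sq_sum_le [CompleteSpace H] {C : ℝ}
    (hg : ∀ (s : Finset ι) (x : ι → ℂ), ‖∑ i ∈ s, x i • g i‖ ^ 2 ≤ C * ∑ i ∈ s, ‖x i‖ ^ 2)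
    (x : Ell2 ι) : Summable fun i => x i • g i := by
  rw [summable_iff_vanishing_norm]
  intro ε hε
  have hsmall := summable_iff_vanishing_norm.mp ((Ell2.hasSum_norm_sq x).summable.mul_left C)
    (ε ^ 2) (by positivity)
  obtain ⟨s, hs⟩ := hsmall
  refine ⟨s, fun t ht => lt_of_pow_lt_pow_left₀ 2 hε.le ?_⟩
  calc ‖∑ i ∈ t, x i • g i‖ ^ 2 ≤ ∑ i ∈ t, C * ‖x i‖ ^ 2 := by
        simpa only [Finset.mul_sum] using hg t x
    _ ≤ ‖∑ i ∈ t, C * ‖x i‖ ^ 2‖ := Real.le_norm_self _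
    _ < ε ^ 2 := hs t ht

theorem isBessel_of_norm_sq_sum_le [CompleteSpace H] {C : ℝ} (hC : 0 ≤ C)
    (hg : ∀ (s : Finset ι) (x : ι → ℂ), ‖∑ i ∈ s, x i • g i‖ ^ 2 ≤ C * ∑ i ∈ s, ‖x i‖ ^ 2) :
    IsBessel g := by
  have hs := summable_smul_of_norm_sq_sum_le hg
  let S : Ell2 ι →ₗ[ℂ] H :=
    { toFun := fun x => ∑' i, x i • g i
      map_add' := fun x y => by
        rw [← (hs x).tsum_add (hs y)]
        exact tsum_congr fun i => add_smul _ _ _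
      map_smul' := fun c x => by
        rw [RingHom.id_apply, ← (hs x).tsum_const_smul]
        exact tsum_congr fun i => mul_smul c (x i) (g i) }
  refine ⟨S.mkContinuous (Real.sqrt C) fun x => ?_, fun x => (hs x).hasSum⟩
  refine le_of_sq_le_sq ?_ (by positivity)
  rw [mul_pow, Real.sq_sqrt hC]
  refine le_of_tendsto ((hs x).hasSum.norm.pow 2) (Eventually.of_forall fun s => ?_)
  refine (hg s x).trans ?_
  gcongr
  exact sum_le_hasSum s (fun _ _ => by positivity) (Ell2.hasSum_norm_sq x)

theorem norm_sq_sum_le_sum_norm_inner (s : Finset ι) (x : ι → ℂ) (g : ι → H) :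
    ‖∑ i ∈ s, x i • g i‖ ^ 2 ≤
      ∑ i ∈ s, ∑ j ∈ s, ‖x i‖ * ‖x j‖ * ‖inner ℂ (g i) (g j)‖ := by
  rw [norm_sq_eq_re_inner (𝕜 := ℂ), inner_self_re_eq_norm, sum_inner]
  refine (norm_sum_le _ _).trans (Finset.sum_le_sum fun i _ => ?_)
  rw [inner_sum]
  refine (norm_sum_le _ _).trans_eq (Finset.sum_congr rfl fun j _ => ?_)
  rw [inner_smul_left, inner_smul_right, norm_mul, norm_mul, RCLike.norm_conj, mul_assoc]

theorem isBessel_of_gram [CompleteSpace H] [DecidableEq ι] {B : ℝ} (hB : ∀ i, ‖g i‖ ^ 2 ≤ B)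
    (hg : Summable fun p : ι × ι => if p.1 = p.2 then 0 else ‖inner ℂ (g p.1) (g p.2)‖) :
    IsBessel g := by
  set F : ι × ι → ℝ := fun p => if p.1 = p.2 then 0 else ‖inner ℂ (g p.1) (g p.2)‖ with hF
  have hF0 : ∀ p, 0 ≤ F p := fun p => by simp only [hF]; split_ifs <;> positivity
  refine isBessel_of_norm_sq_sum_le (C := |B| + ∑' p, F p)
    (add_nonneg (abs_nonneg B) (tsum_nonneg hF0)) fun s x =>
      (norm_sq_sum_le_sum_norm_inner s x g).trans ?_
  set X := ∑ i ∈ s, ‖x i‖ ^ 2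
  have hx : ∀ i ∈ s, ‖x i‖ ^ 2 ≤ X := fun i hi =>
    Finset.single_le_sum (f := fun i => ‖x i‖ ^ 2) (fun _ _ => by positivity) hi
  have hterm : ∀ i ∈ s, ∀ j ∈ s, ‖x i‖ * ‖x j‖ * ‖inner ℂ (g i) (g j)‖ ≤
      (if i = j then |B| * ‖x i‖ ^ 2 else 0) + X * F (i, j) := by
    intro i hi j hj
    rcases eq_or_ne i j with rfl | hij
    · simp only [hF, if_true, mul_zero, add_zero, ← inner_self_re_eq_norm,
        ← norm_sq_eq_re_inner]
      nlinarith [mul_le_mul_of_nonneg_left ((hB i).trans (le_abs_self B)) (sq_nonneg ‖x i‖)]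
    · simp only [hF, if_neg hij, zero_add]
      gcongr
      nlinarith [hx i hi, hx j hj, sq_nonneg (‖x i‖ - ‖x j‖)]
  calc _ ≤ ∑ i ∈ s, ∑ j ∈ s, ((if i = j then |B| * ‖x i‖ ^ 2 else 0) + X * F (i, j)) :=
        Finset.sum_le_sum fun i hi => Finset.sum_le_sum fun j hj => hterm i hi j hj
    _ = |B| * X + X * ∑ p ∈ s ×ˢ s, F p := by
        simp only [Finset.sum_add_distrib, Finset.mul_sum, Finset.sum_product, X]
        congr 1
        exact Finset.sum_congr rfl fun i hi => by rw [Finset.sum_ite_eq, if_pos hi]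
    _ ≤ (|B| + ∑' p, F p) * X := by
        nlinarith [mul_le_mul_of_nonneg_left (hg.sum_le_tsum (s ×ˢ s) fun p _ => hF0 p)
          (Finset.sum_nonneg fun i (_ : i ∈ s) => sq_nonneg ‖x i‖)]

end Bessel

/-! ### Test functions and their Fourier transforms -/

section TestFunctions

open scoped ContDiff

variable {T : ℝ} {E F : Type*} [NormedAddCommGroup E] [NormedSpace ℝ E] [NormedAddCommGroup F]
  [NormedSpace ℝ F] {g h : ℝ → E}

/-- `g ∈ C_c^∞((0, T), E)`: the vector-valued version of `IsTest`. -/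
structure IsTestFun (T : ℝ) (g : ℝ → E) : Prop where
  smooth : ContDiff ℝ ∞ g
  supp : tsupport g ⊆ Ioo 0 T

theorem IsTest.isTestFun {φ : ℝ → ℝ} (hφ : IsTest T φ) : IsTestFun T φ := ⟨hφ.smooth, hφ.supp⟩

namespace IsTestFun

theorem hasCompactSupport (hg : IsTestFun T g) : HasCompactSupport g :=
  isCompact_Icc.of_isClosed_subset (isClosed_tsupport g) (hg.supp.trans Ioo_subset_Icc_self)

theorem isTest {φ : ℝ → ℝ} (hφ : IsTestFun T φ) : IsTest T φ :=
  ⟨hφ.smooth, hφ.hasCompactSupport, hφ.supp⟩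

theorem apply_eq_zero (hg : IsTestFun T g) {t : ℝ} (ht : t ∉ Ioo 0 T) : g t = 0 :=
  image_eq_zero_of_notMem_tsupport fun h => ht (hg.supp h)

theorem continuous (hg : IsTestFun T g) : Continuous g := hg.smooth.continuous

theorem hasDerivAt (hg : IsTestFun T g) (t : ℝ) : HasDerivAt g (deriv g t) t :=
  (hg.smooth.differentiable (by simp)).differentiableAt.hasDerivAt

theorem add (hg : IsTestFun T g) (hh : IsTestFun T h) : IsTestFun T (g + h) :=
  ⟨hg.smooth.add hh.smooth, (tsupport_add g h).trans (union_subset hg.supp hh.supp)⟩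

theorem mul_contDiff {A : Type*} [NormedRing A] [NormedAlgebra ℝ A] {g h : ℝ → A}
    (hg : IsTestFun T g) (hh : ContDiff ℝ ∞ h) : IsTestFun T (g * h) :=
  ⟨hg.smooth.mul hh, tsupport_mul_subset_left.trans hg.supp⟩

theorem clm_comp (hg : IsTestFun T g) (L : E →L[ℝ] F) : IsTestFun T (L ∘ g) :=
  ⟨L.contDiff.comp hg.smooth, (tsupport_comp_subset (map_zero L) g).trans hg.supp⟩

theorem deriv (hg : IsTestFun T g) : IsTestFun T (deriv g) :=
  ⟨(contDiff_infty_iff_deriv.mp hg.smooth).2, tsupport_deriv_subset.trans hg.supp⟩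

theorem iteratedDeriv (hg : IsTestFun T g) (n : ℕ) : IsTestFun T (iteratedDeriv n g) := by
  induction n with
  | zero => rwa [iteratedDeriv_zero]
  | succ n ih =>
    rw [iteratedDeriv_succ]
    exact ih.deriv

theorem deriv_clm_comp (hg : IsTestFun T g) (L : E →L[ℝ] F) :
    _root_.deriv (L ∘ g) = L ∘ _root_.deriv g :=
  funext fun t => (L.hasFDerivAt.comp_hasDerivAt t (hg.hasDerivAt t)).deriv

theorem iteratedDeriv_clm_comp (hg : IsTestFun T g) (L : E →L[ℝ] F) (n : ℕ) :
    _root_.iteratedDeriv n (L ∘ g) = L ∘ _root_.iteratedDeriv n g := by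
  induction n with
  | zero => simp only [iteratedDeriv_zero]
  | succ n ih =>
    rw [iteratedDeriv_succ, ih, (hg.iteratedDeriv n).deriv_clm_comp, iteratedDeriv_succ]

theorem memLp (hg : IsTestFun T g) (p : ℝ≥0∞) : MemLp g p (μI T) :=
  (hg.continuous.memLp_of_hasCompactSupport hg.hasCompactSupport).restrict _

theorem integrable (hg : IsTestFun T g) : Integrable g (μI T) :=
  memLp_one_iff_integrable.mp (hg.memLp 1)

/-- The class in `L²((0, T), E)` of a test function. -/
def toL2 (hg : IsTestFun T g) : Lp E 2 (μI T) := (hg.memLp 2).toLp g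

theorem coeFn_toL2 (hg : IsTestFun T g) : hg.toL2 =ᵐ[μI T] g := (hg.memLp 2).coeFn_toLp

theorem toL2_congr (hg : IsTestFun T g) (hh : IsTestFun T h) (hgh : g = h) :
    hg.toL2 = hh.toL2 := by
  subst hgh
  rfl

theorem compLp_toL2 (hg : IsTestFun T g) (L : E →L[ℝ] F) :
    L.compLp hg.toL2 = (hg.clm_comp L).toL2 := by
  apply Lp.ext
  filter_upwards [L.coeFn_compLp hg.toL2, hg.coeFn_toL2, (hg.clm_comp L).coeFn_toL2]
    with t h1 h2 h3
  rw [h1, h2, h3, Function.comp_apply]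

theorem intervalIntegral_deriv [CompleteSpace E] (hg : IsTestFun T g) (t : ℝ) :
    ∫ τ in (0 : ℝ)..t, _root_.deriv g τ = g t := by
  rw [intervalIntegral.integral_eq_sub_of_hasDerivAt (fun τ _ => hg.hasDerivAt τ)
    (hg.deriv.continuous.intervalIntegrable _ _), hg.apply_eq_zero (t := 0) (by simp), sub_zero]

theorem integral_deriv [CompleteSpace E] (hg : IsTestFun T g) :
    ∫ t in Ioo 0 T, _root_.deriv g t = 0 := by
  rcases le_total T 0 with hT | hT
  · simp [Ioo_eq_empty_of_le hT]
  · rw [← integral_Ioc_eq_integral_Ioo, ← intervalIntegral.integral_of_le hT,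
      hg.intervalIntegral_deriv, hg.apply_eq_zero (by simp)]

theorem star {ρ : ℝ → ℂ} (hρ : IsTestFun T ρ) : IsTestFun T (star ρ) :=
  hρ.clm_comp Complex.conjCLE.toContinuousLinearMap

theorem inner_toL2 {𝕜 : Type*} [RCLike 𝕜] {ρ θ : ℝ → 𝕜} (hρ : IsTestFun T ρ)
    (hθ : IsTestFun T θ) : inner 𝕜 hρ.toL2 hθ.toL2 = ∫ t in Ioo 0 T, (Star.star ρ * θ) t := by
  rw [L2.inner_def]
  apply integral_congr_ae
  filter_upwards [hρ.coeFn_toL2, hθ.coeFn_toL2] with t h1 h2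
  rw [h1, h2, RCLike.inner_apply, mul_comm]
  rfl

end IsTestFun

/-- The character `t ↦ e^{ixt}`. -/
def expI (x t : ℝ) : ℂ := Complex.exp (Complex.I * x * t)

theorem norm_expI (x t : ℝ) : ‖expI x t‖ = 1 := by
  rw [expI, mul_assoc, mul_comm, ← Complex.ofReal_mul]
  exact Complex.norm_exp_ofReal_mul_I _

theorem expI_add (x y t : ℝ) : expI (x + y) t = expI x t * expI y t := by
  rw [expI, expI, expI, ← Complex.exp_add]
  push_cast
  ring_nf

theorem star_expI (x t : ℝ) : star (expI x t) = expI (-x) t := by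
  rw [expI, expI, Complex.star_def, ← Complex.exp_conj]
  simp

theorem hasDerivAt_expI (x t : ℝ) : HasDerivAt (expI x) (expI x t * (Complex.I * x)) t := by
  refine HasDerivAt.cexp ?_
  simpa using (Complex.ofRealCLM.hasDerivAt (x := t)).const_mul (Complex.I * (x : ℂ))

theorem contDiff_expI (x : ℝ) : ContDiff ℝ ∞ (expI x) :=
  (contDiff_const.mul Complex.ofRealCLM.contDiff).cexp

/-- The Fourier transform `∫₀ᵀ g(t) e^{ixt} dt`. -/
def hat (T : ℝ) (g : ℝ → ℂ) (x : ℝ) : ℂ := ∫ t in Ioo 0 T, g t * expI x t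

variable {ρ θ : ℝ → ℂ}

theorem hat_deriv (hρ : IsTestFun T ρ) (x : ℝ) :
    hat T (deriv ρ) x = -(Complex.I * x) * hat T ρ x := by
  have hint := (hρ.mul_contDiff (contDiff_expI x)).integral_deriv
  have hderiv : deriv (ρ * expI x) =
      deriv ρ * expI x + fun t => Complex.I * x * (ρ * expI x) t := by
    funext t
    rw [((hρ.hasDerivAt t).mul (hasDerivAt_expI x t)).deriv]
    simp only [Pi.add_apply, Pi.mul_apply]
    ring
  rw [hderiv, integral_add' (hρ.deriv.mul_contDiff (contDiff_expI x)).integrable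
    ((hρ.mul_contDiff (contDiff_expI x)).integrable.const_mul _), integral_const_mul] at hint
  change _ + Complex.I * x * hat T ρ x = 0 at hint
  change hat T (deriv ρ) x + _ = 0 at hint
  linear_combination hint

theorem hat_iteratedDeriv (hρ : IsTestFun T ρ) (n : ℕ) (x : ℝ) :
    hat T (iteratedDeriv n ρ) x = (-(Complex.I * x)) ^ n * hat T ρ x := by
  induction n with
  | zero => simp
  | succ n ih =>
    rw [iteratedDeriv_succ, hat_deriv (hρ.iteratedDeriv n), ih]
    ring

theorem norm_hat_le (T : ℝ) (ρ : ℝ → ℂ) (x : ℝ) : ‖hat T ρ x‖ ≤ ∫ t in Ioo 0 T, ‖ρ t‖ := by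
  refine (norm_integral_le_integral_norm _).trans_eq ?_
  simp only [norm_mul, norm_expI, mul_one]

theorem IsTestFun.exists_pow_mul_norm_hat_le (hρ : IsTestFun T ρ) (n : ℕ) :
    ∃ C : ℝ, ∀ x : ℝ, (1 + |x|) ^ n * ‖hat T ρ x‖ ≤ C := by
  refine ⟨2 ^ (n - 1) * ((∫ t in Ioo 0 T, ‖ρ t‖) + ∫ t in Ioo 0 T, ‖_root_.iteratedDeriv n ρ t‖),
    fun x => ?_⟩
  have hn : |x| ^ n * ‖hat T ρ x‖ ≤ ∫ t in Ioo 0 T, ‖_root_.iteratedDeriv n ρ t‖ := by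
    simpa [hat_iteratedDeriv hρ] using norm_hat_le T (_root_.iteratedDeriv n ρ) x
  calc (1 + |x|) ^ n * ‖hat T ρ x‖ ≤ (2 ^ (n - 1) * (1 ^ n + |x| ^ n)) * ‖hat T ρ x‖ := by
        gcongr
        exact add_pow_le zero_le_one (abs_nonneg x) n
    _ = 2 ^ (n - 1) * (‖hat T ρ x‖ + |x| ^ n * ‖hat T ρ x‖) := by ring
    _ ≤ _ := by
        gcongr
        exact norm_hat_le T ρ x

/-- The modulated profile `ρ(t) e^{-ixt}`. -/
def mode (ρ : ℝ → ℂ) (x : ℝ) : ℝ → ℂ := ρ * expI (-x)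

theorem IsTestFun.mode (hρ : IsTestFun T ρ) (x : ℝ) : IsTestFun T (mode ρ x) :=
  hρ.mul_contDiff (contDiff_expI (-x))

theorem hat_mode (T : ℝ) (ρ : ℝ → ℂ) (x y : ℝ) : hat T (mode ρ x) y = hat T ρ (y - x) := by
  refine integral_congr_ae (Eventually.of_forall fun t => ?_)
  simp only [mode, Pi.mul_apply, sub_eq_neg_add, expI_add, mul_assoc]

theorem inner_toL2_mode (hρ : IsTestFun T ρ) (hθ : IsTestFun T θ) (x y : ℝ) :
    inner ℂ (hρ.mode x).toL2 (hθ.mode y).toL2 = hat T (star ρ * θ) (x - y) := by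
  rw [IsTestFun.inner_toL2, hat]
  refine integral_congr_ae (Eventually.of_forall fun t => ?_)
  simp only [mode, Pi.mul_apply, Pi.star_apply, star_mul', star_expI, neg_neg, sub_eq_add_neg,
    expI_add]
  ring

theorem norm_sq_toL2_mode_le (hρ : IsTestFun T ρ) (x : ℝ) :
    ‖(hρ.mode x).toL2‖ ^ 2 ≤ ∫ t in Ioo 0 T, ‖(star ρ * ρ) t‖ := by
  rw [norm_sq_eq_re_inner (𝕜 := ℂ), inner_self_re_eq_norm, inner_toL2_mode hρ hρ]
  exact norm_hat_le _ _ _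

theorem deriv_mode (hρ : IsTestFun T ρ) (x : ℝ) :
    deriv (mode ρ x) = mode (deriv ρ) x + (-(Complex.I * x)) • mode ρ x := by
  funext t
  rw [mode, ((hρ.hasDerivAt t).mul (hasDerivAt_expI (-x) t)).deriv]
  simp only [mode, Pi.add_apply, Pi.mul_apply, Pi.smul_apply, smul_eq_mul, Complex.ofReal_neg]
  ring

theorem iteratedDeriv_succ_mode (hρ : IsTestFun T ρ) (x : ℝ) (m : ℕ) :
    iteratedDeriv (m + 1) (mode ρ x) =
      iteratedDeriv m (mode (deriv ρ) x) + (-(Complex.I * x)) • iteratedDeriv m (mode ρ x) := by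
  have hsmooth : ∀ {g : ℝ → ℂ}, IsTestFun T g → ∀ t, ContDiffAt ℝ m g t := fun hg t =>
    (hg.smooth.of_le (by exact_mod_cast le_top)).contDiffAt
  rw [iteratedDeriv_succ', deriv_mode hρ]
  funext t
  have hsmul : ContDiffAt ℝ m ((-(Complex.I * x)) • mode ρ x) t :=
    ContDiffAt.const_smul (-(Complex.I * (x : ℂ))) (hsmooth (hρ.mode x) t)
  rw [iteratedDeriv_add (hsmooth (hρ.deriv.mode x) t) hsmul, iteratedDeriv_const_smul_field,
    Pi.add_apply, Pi.smul_apply]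

theorem toL2_iteratedDeriv_succ_mode (hρ : IsTestFun T ρ) (x : ℝ) (m : ℕ) :
    ((hρ.mode x).iteratedDeriv (m + 1)).toL2 = ((hρ.deriv.mode x).iteratedDeriv m).toL2 +
      (-(Complex.I * x)) • ((hρ.mode x).iteratedDeriv m).toL2 := by
  simp only [IsTestFun.toL2, iteratedDeriv_succ_mode hρ]
  rfl

end TestFunctions

/-! ### Gram operators of sparse frequencies -/

section Gram

variable {ι : Type*} {lam : ι → ℝ} {T : ℝ} {ρ θ σ : ℝ → ℂ}

/-- Separation of frequencies in the mean: `∑_{i ≠ j} |λ_i - λ_j|^{-M} < ∞` for some `M`. The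
diagonal terms of the series below vanish as soon as `M ≠ 0`, since `0⁻¹ = 0`. -/
def PowSeparated (lam : ι → ℝ) : Prop :=
  ∃ M : ℕ, Summable fun p : ι × ι => (|lam p.1 - lam p.2|⁻¹) ^ M

/-- Distinct separated frequencies, bounded away from `0`. -/
structure SparseFreq (lam : ι → ℝ) : Prop where
  inj : Function.Injective lam
  pos : ∃ δ : ℝ, 0 < δ ∧ ∀ i, δ ≤ |lam i|
  sep : PowSeparated lam

namespace SparseFreq

theorem ne_zero (h : SparseFreq lam) (i : ι) : lam i ≠ 0 := by
  obtain ⟨δ, hδ, hle⟩ := h.pos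
  exact abs_pos.mp (hδ.trans_le (hle i))

theorem ofReal_ne_zero (h : SparseFreq lam) (i : ι) : (lam i : ℂ) ≠ 0 :=
  Complex.ofReal_ne_zero.mpr (h.ne_zero i)

theorem bddAbove_norm_inv (h : SparseFreq lam) :
    BddAbove (range fun i => ‖(lam i : ℂ)⁻¹‖) := by
  obtain ⟨δ, hδ, hle⟩ := h.pos
  refine ⟨δ⁻¹, forall_mem_range.mpr fun i => ?_⟩
  rw [norm_inv, Complex.norm_real, Real.norm_eq_abs]
  exact inv_anti₀ hδ (hle i)

/-- Division by the frequencies, as an operator on `ℓ²`. -/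
def invOp (h : SparseFreq lam) : Ell2 ι →L[ℂ] Ell2 ι :=
  diagOp (fun i => (lam i : ℂ)⁻¹) h.bddAbove_norm_inv

theorem invOp_pow_apply (h : SparseFreq lam) (n : ℕ) (x : Ell2 ι) (i : ι) :
    (h.invOp ^ n) x i = ((lam i : ℂ) ^ n)⁻¹ * x i := by
  rw [invOp, diagOp_pow_apply, inv_pow]

theorem eq_zero_of_invOp_pow_apply_eq_zero (h : SparseFreq lam) {n : ℕ} {x : Ell2 ι}
    (hx : (h.invOp ^ n) x = 0) : x = 0 := by
  ext i
  have hi : ((lam i : ℂ) ^ n)⁻¹ * x i = 0 := by rw [← h.invOp_pow_apply, hx]; rfl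
  exact (mul_eq_zero.mp hi).resolve_left (inv_ne_zero (pow_ne_zero n (h.ofReal_ne_zero i)))

theorem exists_abs_le_mul (h : SparseFreq lam) :
    ∃ c : ℝ, ∀ l j, |lam l| ≤ c * (1 + |lam l - lam j|) * |lam j| := by
  obtain ⟨δ, hδ, hle⟩ := h.pos
  refine ⟨1 + δ⁻¹, fun l j => ?_⟩
  have hδj : 1 ≤ δ⁻¹ * |lam j| := by
    rw [inv_mul_eq_div, one_le_div hδ]
    exact hle j
  calc |lam l| ≤ |lam l - lam j| * 1 + |lam j| := by
        simpa using abs_add_le (lam l - lam j) (lam j)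
    _ ≤ |lam l - lam j| * (δ⁻¹ * |lam j|) + |lam j| := by gcongr
    _ ≤ |lam l - lam j| * (δ⁻¹ * |lam j|) + |lam j| +
          (δ⁻¹ * |lam j| + |lam l - lam j| * |lam j|) := le_add_of_nonneg_right (by positivity)
    _ = (1 + δ⁻¹) * (1 + |lam l - lam j|) * |lam j| := by ring

theorem summable_hat [DecidableEq ι] (h : SparseFreq lam) (hρ : IsTestFun T ρ) (q : ℕ) :
    Summable fun p : ι × ι => if p.1 = p.2 then 0 else
      (1 + |lam p.1 - lam p.2|) ^ q * ‖hat T ρ (lam p.1 - lam p.2)‖ := by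
  obtain ⟨M, hM⟩ := h.sep
  obtain ⟨C, hC⟩ := hρ.exists_pow_mul_norm_hat_le (q + M)
  have hC0 : 0 ≤ C := le_trans (by positivity) (hC 0)
  refine Summable.of_nonneg_of_le (fun p => ?_) (fun p => ?_) (hM.mul_left C)
  · split_ifs <;> positivity
  · split_ifs with hp
    · positivity
    · have hpos : 0 < |lam p.1 - lam p.2| := abs_pos.mpr (sub_ne_zero.mpr (h.inj.ne hp))
      rw [inv_pow, ← div_eq_mul_inv, le_div_iff₀ (by positivity)]
      refine le_trans ?_ (hC (lam p.1 - lam p.2))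
      rw [pow_add, mul_right_comm]
      gcongr
      exact le_add_of_nonneg_left zero_le_one

theorem isBessel_mode (h : SparseFreq lam) (hρ : IsTestFun T ρ) :
    IsBessel fun i => (hρ.mode (lam i)).toL2 := by
  classical
  refine isBessel_of_gram (fun i => norm_sq_toL2_mode_le hρ _) ?_
  simpa only [inner_toL2_mode hρ hρ, pow_zero, one_mul] using
    h.summable_hat (hρ.star.mul_contDiff hρ.smooth) 0

theorem isBessel_iteratedDeriv_mode (h : SparseFreq lam) (hρ : IsTestFun T ρ) (m : ℕ) :
    IsBessel fun i => ((lam i : ℂ) ^ m)⁻¹ • ((hρ.mode (lam i)).iteratedDeriv m).toL2 := by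
  induction m generalizing ρ with
  | zero => simpa [IsTestFun.toL2] using h.isBessel_mode hρ
  | succ m ih =>
    have hI : BddAbove (range fun _ : ι => ‖-Complex.I‖) :=
      ⟨‖-Complex.I‖, forall_mem_range.mpr fun _ => le_rfl⟩
    convert ((ih hρ.deriv).smul h.bddAbove_norm_inv).add ((ih hρ).smul hI) using 2 with i
    have hi := h.ofReal_ne_zero i
    rw [toL2_iteratedDeriv_succ_mode hρ, smul_add, smul_smul, smul_smul, smul_smul]
    congr 2 <;> field_simp <;> ring

end SparseFreq

/-- The off-diagonal part of the Gram matrix `ρ̂(λ_l - λ_j)`, conjugated by the weights `λ^q`. -/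
def gramKernel (T : ℝ) (lam : ι → ℝ) (ρ : ℝ → ℂ) [DecidableEq ι] (q : ℕ) (l j : ι) : ℂ :=
  if l = j then 0 else (lam l : ℂ) ^ q * ((lam j : ℂ) ^ q)⁻¹ * hat T ρ (lam l - lam j)

/-- The Gram operator `x ↦ (∑_j ρ̂(λ_l - λ_j) x_j)_l` of the modes, conjugated by the weights
`λ^q`, for a profile normalized by `ρ̂(0) = 1`. -/
def gramOp (T : ℝ) (lam : ι → ℝ) (ρ : ℝ → ℂ) [DecidableEq ι] (q : ℕ) : Ell2 ι →L[ℂ] Ell2 ι :=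
  1 + matOp (gramKernel T lam ρ q)

namespace SparseFreq

variable [DecidableEq ι]

theorem summable_gramKernel (h : SparseFreq lam) (hρ : IsTestFun T ρ) (q : ℕ) :
    Summable fun p : ι × ι => ‖gramKernel T lam ρ q p.1 p.2‖ := by
  obtain ⟨c, hc⟩ := h.exists_abs_le_mul
  refine Summable.of_nonneg_of_le (fun _ => norm_nonneg _) (fun p => ?_)
    ((h.summable_hat hρ q).mul_left (c ^ q))
  unfold gramKernel
  split_ifs
  · simp
  · rw [norm_mul, norm_mul, norm_inv, norm_pow, norm_pow, Complex.norm_real, Complex.norm_real,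
      Real.norm_eq_abs, Real.norm_eq_abs, ← mul_assoc, ← div_eq_mul_inv, ← div_pow, ← mul_pow]
    gcongr
    exact (div_le_iff₀ (abs_pos.mpr (h.ne_zero _))).mpr (hc _ _)

theorem hasSum_gramOp_apply (h : SparseFreq lam) (hρ : IsTestFun T ρ) (hρ1 : hat T ρ 0 = 1)
    (q : ℕ) (x : Ell2 ι) (l : ι) :
    HasSum (fun j => (lam l : ℂ) ^ q * ((lam j : ℂ) ^ q)⁻¹ * hat T ρ (lam l - lam j) * x j)
      (gramOp T lam ρ q x l) := by
  refine ((hasSum_ite_eq l (x l)).add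
    (hasSum_matOp_apply (h.summable_gramKernel hρ q) x l)).congr_fun fun j => ?_
  rcases eq_or_ne j l with rfl | hj
  · simp [gramKernel, hρ1, mul_inv_cancel₀ (pow_ne_zero q (h.ofReal_ne_zero j))]
  · simp [gramKernel, hj, hj.symm]

theorem gramKernel_mul_inv (h : SparseFreq lam) (q : ℕ) (l j : ι) :
    gramKernel T lam ρ q l j * (lam j : ℂ)⁻¹ =
      (lam l : ℂ)⁻¹ * gramKernel T lam ρ (q + 1) l j := by
  have hl := h.ofReal_ne_zero l
  unfold gramKernel
  split_ifs
  · simp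
  · field_simp
    ring

theorem gramOp_mul_invOp_pow (h : SparseFreq lam) (hρ : IsTestFun T ρ) (q p : ℕ) :
    gramOp T lam ρ q * h.invOp ^ p = h.invOp ^ p * gramOp T lam ρ (q + p) := by
  induction p with
  | zero => simp
  | succ p ih =>
    have hcomm : gramOp T lam ρ (q + p) * h.invOp = h.invOp * gramOp T lam ρ (q + p + 1) := by
      rw [gramOp, gramOp, add_mul, mul_add, one_mul, mul_one, invOp, matOp_mul_diagOp
        (h.summable_gramKernel hρ _) (h.summable_gramKernel hρ _) _ (h.gramKernel_mul_inv _)]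
    rw [pow_succ, ← mul_assoc, ih, mul_assoc, hcomm, ← mul_assoc, add_assoc]

theorem gramOp_invOp_pow_apply (h : SparseFreq lam) (hρ : IsTestFun T ρ) (q p : ℕ) (x : Ell2 ι) :
    gramOp T lam ρ q ((h.invOp ^ p) x) = (h.invOp ^ p) (gramOp T lam ρ (q + p) x) :=
  congrArg (fun K : Ell2 ι →L[ℂ] Ell2 ι => K x) (h.gramOp_mul_invOp_pow hρ q p)

end SparseFreq

/-- A real test function `σ` on `(0, T)` with `∫ σ² = 1`. The Gram matrix of the profile `σ²`
is positive semidefinite because `σ²` is a square. -/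
structure IsWindow (T : ℝ) (σ : ℝ → ℂ) : Prop where
  isTestFun : IsTestFun T σ
  star_eq : star σ = σ
  hat_mul_self_zero : hat T (σ * σ) 0 = 1

theorem IsWindow.mul_self (hσ : IsWindow T σ) : IsTestFun T (σ * σ) :=
  hσ.isTestFun.mul_contDiff hσ.isTestFun.smooth

namespace SparseFreq

theorem hasSum_inner_mode_synthesis (h : SparseFreq lam) (hσ : IsTestFun T σ)
    (hθ : IsTestFun T θ) (x : Ell2 ι) (l : ι) :
    HasSum (fun j => hat T (star θ * σ) (lam l - lam j) * x j)
      (inner ℂ (hθ.mode (lam l)).toL2 ((h.isBessel_mode hσ).synthesis x)) := by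
  simpa [inner_smul_right, inner_toL2_mode hθ hσ, mul_comm] using
    ((h.isBessel_mode hσ).hasSum_synthesis x).mapL (innerSL ℂ (hθ.mode (lam l)).toL2)

variable [DecidableEq ι]

theorem hasSum_gramOp_zero_apply (h : SparseFreq lam) (hσ : IsWindow T σ) (x : Ell2 ι) (l : ι) :
    HasSum (fun j => hat T (σ * σ) (lam l - lam j) * x j) (gramOp T lam (σ * σ) 0 x l) := by
  simpa using h.hasSum_gramOp_apply hσ.mul_self hσ.hat_mul_self_zero 0 x l

theorem synthesis_eq_zero (h : SparseFreq lam) (hσ : IsWindow T σ) {x : Ell2 ι}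
    (hx : gramOp T lam (σ * σ) 0 x = 0) : (h.isBessel_mode hσ.isTestFun).synthesis x = 0 := by
  set S := (h.isBessel_mode hσ.isTestFun).synthesis
  have horth : ∀ l, inner ℂ (S x) (hσ.isTestFun.mode (lam l)).toL2 = 0 := fun l => by
    have hinner := h.hasSum_inner_mode_synthesis hσ.isTestFun hσ.isTestFun x l
    rw [hσ.star_eq] at hinner
    rw [← inner_conj_symm, hinner.unique (h.hasSum_gramOp_zero_apply hσ x l), hx]
    exact map_zero _
  have hsum := ((h.isBessel_mode hσ.isTestFun).hasSum_synthesis x).mapL (innerSL ℂ (S x))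
  simp only [innerSL_apply_apply, inner_smul_right, horth, mul_zero] at hsum
  exact inner_self_eq_zero.mp (hsum.unique hasSum_zero)

/-- The kernel of the Gram operator is stable under multiplication by the frequencies: pairing
`∑ x_j σ e^{-iλ_j t} = 0` with `2σ' e^{-iλ_l t}` multiplies the Gram matrix by `λ_l - λ_j`. -/
theorem gramOp_eq_zero_of_gramOp_invOp_eq_zero (h : SparseFreq lam) (hσ : IsWindow T σ)
    {z : Ell2 ι} (hz : gramOp T lam (σ * σ) 0 (h.invOp z) = 0) :
    gramOp T lam (σ * σ) 0 z = 0 := by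
  have hθ : IsTestFun T (star (deriv σ + deriv σ)) :=
    (hσ.isTestFun.deriv.add hσ.isTestFun.deriv).star
  have hθσ : star (star (deriv σ + deriv σ)) * σ = deriv (σ * σ) := by
    funext t
    rw [star_star, ((hσ.isTestFun.hasDerivAt t).mul (hσ.isTestFun.hasDerivAt t)).deriv]
    simp only [Pi.mul_apply, Pi.add_apply]
    ring
  ext l
  have hder := h.hasSum_inner_mode_synthesis hσ.isTestFun hθ (h.invOp z) l
  have hgram := h.hasSum_gramOp_zero_apply hσ (h.invOp z) l
  rw [h.synthesis_eq_zero hσ hz, inner_zero_right, hθσ] at hder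
  rw [hz] at hgram
  refine (h.hasSum_gramOp_zero_apply hσ z l).unique ?_
  have hcomb := (hgram.mul_left (lam l : ℂ)).sub (hder.mul_left Complex.I)
  simp only [lp.coeFn_zero, Pi.zero_apply, mul_zero, sub_zero] at hcomb
  refine hcomb.congr_fun fun j => ?_
  rw [hat_deriv hσ.mul_self, invOp, diagOp_apply]
  have hj := h.ofReal_ne_zero j
  field_simp
  push_cast
  linear_combination -hat T (σ * σ) (lam l - lam j) * z j * (lam l - lam j) * Complex.I_sq

theorem gramOp_single_ne_zero (h : SparseFreq lam) (hσ : IsWindow T σ) (i : ι) :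
    gramOp T lam (σ * σ) 0 (lp.single 2 i 1) ≠ 0 := fun h0 => by
  have hsum := h.hasSum_gramOp_zero_apply hσ (lp.single 2 i 1) i
  rw [h0] at hsum
  have hsingle := hasSum_single (f := fun j => hat T (σ * σ) (lam i - lam j) *
    (lp.single 2 i (1 : ℂ) : Ell2 ι) j) i fun j hj => by simp [hj]
  have h01 := hsum.unique hsingle
  simp [hσ.hat_mul_self_zero] at h01

theorem eq_zero_of_gramOp_zero_eq_zero (h : SparseFreq lam) (hσ : IsWindow T σ) {x : Ell2 ι}
    (hx : gramOp T lam (σ * σ) 0 x = 0) : x = 0 := by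
  have hsum := h.summable_gramKernel hσ.mul_self
  let N := LinearMap.ker (gramOp T lam (σ * σ) 0).toLinearMap
  have hNeig : N =
      Module.End.eigenspace (matOp (gramKernel T lam (σ * σ) 0)).toLinearMap (-1) := by
    ext y
    rw [LinearMap.mem_ker, Module.End.mem_eigenspace_iff, neg_one_smul, eq_neg_iff_add_eq_zero,
      add_comm]
    rfl
  have : FiniteDimensional ℂ N := hNeig ▸ ContinuousLinearMap.finite_dimensional_eigenspace
    (isCompactOperator_matOp (hsum 0)) (-1) (by norm_num)
  have hN : N ≤ N.map h.invOp.toLinearMap := fun y hy => by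
    obtain ⟨z, rfl⟩ := ker_one_add_matOp_le_range_diagOp (hsum 0) (hsum 1) h.bddAbove_norm_inv
      (fun i => inv_ne_zero (h.ofReal_ne_zero i)) (h.gramKernel_mul_inv 0) hy
    exact ⟨z, h.gramOp_eq_zero_of_gramOp_invOp_eq_zero hσ hy, rfl⟩
  by_contra hx0
  obtain ⟨i, hi⟩ := exists_single_mem_of_le_map_diagOp h.bddAbove_norm_inv
    (fun i => inv_ne_zero (h.ofReal_ne_zero i))
    (inv_injective.comp (Complex.ofReal_injective.comp h.inj)) hN
    ((Submodule.ne_bot_iff N).mpr ⟨x, hx, hx0⟩)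
  exact h.gramOp_single_ne_zero hσ i hi

theorem isUnit_gramOp (h : SparseFreq lam) (hσ : IsWindow T σ) (q : ℕ) :
    IsUnit (gramOp T lam (σ * σ) q) := by
  refine isUnit_one_add_of_isCompactOperator
    (isCompactOperator_matOp (h.summable_gramKernel hσ.mul_self q)) fun x hx => ?_
  refine h.eq_zero_of_invOp_pow_apply_eq_zero (n := q) (h.eq_zero_of_gramOp_zero_eq_zero hσ ?_)
  rw [h.gramOp_invOp_pow_apply hσ.mul_self, zero_add]
  exact (congrArg (h.invOp ^ q) hx).trans (map_zero _)

/-- The solution operator of the moment problem, differentiated `q ≤ s` times: `z` is the sequence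
of the moments multiplied by `λ^s`, and the solution is `∑_i a_i σ² e^{-iλ_i t}` with `λ^s a` the
preimage of `z` under the Gram operator. -/
def solver (h : SparseFreq lam) (hσ : IsWindow T σ) (s q : ℕ) : Ell2 ι →L[ℂ] Lp ℂ 2 (μI T) :=
  (h.isBessel_iteratedDeriv_mode hσ.mul_self q).synthesis.comp
    (h.invOp ^ (s - q) * Ring.inverse (gramOp T lam (σ * σ) s))

theorem hasSum_solver (h : SparseFreq lam) (hσ : IsWindow T σ) {s q : ℕ} (hq : q ≤ s)
    (z : Ell2 ι) :
    HasSum (fun i => (h.invOp ^ s) (Ring.inverse (gramOp T lam (σ * σ) s) z) i •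
      ((hσ.mul_self.mode (lam i)).iteratedDeriv q).toL2) (h.solver hσ s q z) := by
  set y := Ring.inverse (gramOp T lam (σ * σ) s) z
  refine ((h.isBessel_iteratedDeriv_mode hσ.mul_self q).hasSum_synthesis
    ((h.invOp ^ (s - q)) y)).congr_fun fun i => ?_
  rw [smul_smul, h.invOp_pow_apply, h.invOp_pow_apply, mul_right_comm,
    ← mul_inv, ← pow_add, Nat.sub_add_cancel hq]

theorem hasSum_hat_solver (h : SparseFreq lam) (hσ : IsWindow T σ) (s : ℕ) (z : Ell2 ι) (l : ι) :
    HasSum (fun i => (h.invOp ^ s) (Ring.inverse (gramOp T lam (σ * σ) s) z) i *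
      hat T (mode (σ * σ) (lam i)) (lam l)) (((lam l : ℂ) ^ s)⁻¹ * z l) := by
  set y := Ring.inverse (gramOp T lam (σ * σ) s) z
  have hy : gramOp T lam (σ * σ) 0 ((h.invOp ^ s) y) = (h.invOp ^ s) z := by
    rw [h.gramOp_invOp_pow_apply hσ.mul_self, zero_add, ← mul_apply_eq_comp (gramOp _ _ _ _),
      Ring.mul_inverse_cancel _ (h.isUnit_gramOp hσ s), one_apply_eq_self]
  have hsum := h.hasSum_gramOp_zero_apply hσ ((h.invOp ^ s) y) l
  rw [hy, h.invOp_pow_apply] at hsum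
  simpa only [hat_mode, mul_comm] using hsum

theorem exists_norm_solver_le (h : SparseFreq lam) (hσ : IsWindow T σ) {s q : ℕ} (hq : q ≤ s) :
    ∃ C : ℝ, ∀ z, ‖h.solver hσ s q z‖ ≤ C * ‖(h.invOp ^ (s - q)) z‖ := by
  let S := (h.isBessel_iteratedDeriv_mode hσ.mul_self q).synthesis
  let R := fun n => Ring.inverse (gramOp T lam (σ * σ) n)
  have hcomm : h.invOp ^ (s - q) * R s = R q * h.invOp ^ (s - q) := by
    have hG := h.gramOp_mul_invOp_pow hσ.mul_self q (s - q)
    rw [Nat.add_sub_cancel' hq] at hG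
    rw [← Ring.inverse_mul_cancel_left _ (h.invOp ^ (s - q) * R s) (h.isUnit_gramOp hσ q),
      ← mul_assoc (gramOp T lam _ q), hG, mul_assoc,
      Ring.mul_inverse_cancel _ (h.isUnit_gramOp hσ s), mul_one]
  refine ⟨‖S.comp (R q)‖, fun z => ?_⟩
  rw [solver, hcomm]
  exact (S.comp (R q)).le_opNorm _

end SparseFreq

end Gram

/-! ### Moments of square-integrable functions -/

section Moments

variable {T : ℝ}

theorem memLp_expI (T x : ℝ) : MemLp (expI x) 2 (μI T) :=
  MemLp.of_bound (contDiff_expI x).continuous.aestronglyMeasurable 1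
    (Eventually.of_forall fun t => (norm_expI x t).le)

/-- The moment `w ↦ ∫₀ᵀ w(t) e^{ixt} dt` on `L²((0, T), ℂ)`. -/
def momentL (T x : ℝ) : Lp ℂ 2 (μI T) →L[ℂ] ℂ := innerSL ℂ (memLp_expI T (-x)).toLp

theorem momentL_apply (x : ℝ) (w : Lp ℂ 2 (μI T)) :
    momentL T x w = ∫ t in Ioo 0 T, w t * expI x t := by
  rw [momentL, innerSL_apply_apply, L2.inner_def]
  apply integral_congr_ae
  filter_upwards [(memLp_expI T (-x)).coeFn_toLp] with t ht
  rw [ht, RCLike.inner_apply, ← Complex.star_def, star_expI, neg_neg]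

theorem momentL_toL2 (x : ℝ) {g : ℝ → ℂ} (hg : IsTestFun T g) :
    momentL T x hg.toL2 = hat T g x := by
  rw [momentL_apply, hat]
  apply integral_congr_ae
  filter_upwards [hg.coeFn_toL2] with t ht
  rw [ht]

/-- The pointwise real part `L²((0, T), ℂ) → L²((0, T), ℝ)`. -/
def reL (T : ℝ) : Lp ℂ 2 (μI T) →L[ℝ] L2 T := Complex.reCLM.compLpL 2 (μI T)

theorem coeFn_reL (w : Lp ℂ 2 (μI T)) : reL T w =ᵐ[μI T] fun t => (w t).re :=
  Complex.reCLM.coeFn_compLpL w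

theorem norm_reL_le (w : Lp ℂ 2 (μI T)) : ‖reL T w‖ ≤ ‖w‖ := by
  refine Lp.norm_le_norm_of_ae_le ?_
  filter_upwards [coeFn_reL w] with t ht
  rw [ht, Real.norm_eq_abs]
  exact Complex.abs_re_le_norm _

/-- The moment `u ↦ ∫₀ᵀ u(t) e^{ixt} dt` on `L²((0, T), ℝ)`. -/
def realMomentL (T x : ℝ) : L2 T →L[ℝ] ℂ :=
  ((momentL T x).restrictScalars ℝ).comp (Complex.ofRealCLM.compLpL 2 (μI T))

theorem realMomentL_apply (x : ℝ) (u : L2 T) :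
    realMomentL T x u = ∫ t in Ioo 0 T, (u t : ℂ) * expI x t := by
  change momentL T x (Complex.ofRealCLM.compLpL 2 (μI T) u) = _
  rw [momentL_apply]
  apply integral_congr_ae
  filter_upwards [Complex.ofRealCLM.coeFn_compLpL (𝕜 := ℝ) u] with t ht
  rw [ht, Complex.ofRealCLM_apply]

theorem realMomentL_toL2 (x : ℝ) {φ : ℝ → ℝ} (hφ : IsTestFun T φ) :
    realMomentL T x hφ.toL2 = hat T (Complex.ofRealCLM ∘ φ) x := by
  rw [← momentL_toL2 x (hφ.clm_comp _), ← hφ.compLp_toL2]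
  rfl

theorem realMomentL_reL (x : ℝ) (w : Lp ℂ 2 (μI T)) :
    realMomentL T x (reL T w) = (momentL T x w + star (momentL T (-x) w)) / 2 := by
  have hint : ∀ y, Integrable (fun t => w t * expI y t) (μI T) := fun y =>
    (Lp.memLp w).integrable_mul (memLp_expI T y)
  have hstar : star (momentL T (-x) w) = ∫ t in Ioo 0 T, star (w t * expI (-x) t) := by
    rw [momentL_apply]
    exact integral_conj.symm
  have hint' : Integrable (fun t => star (w t * expI (-x) t)) (μI T) :=
    Complex.conjCLE.toContinuousLinearMap.integrable_comp (hint (-x))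
  rw [realMomentL_apply, hstar, momentL_apply, ← integral_add (hint x) hint', ← integral_div]
  apply integral_congr_ae
  filter_upwards [coeFn_reL w] with t ht
  rw [ht, star_mul', star_expI, neg_neg, Complex.re_eq_add_conj, Complex.star_def]
  ring

end Moments

/-! ### The Volterra operator -/

section Volterra

variable {T t : ℝ} {f g : ℝ → ℝ}

theorem intervalIntegral_congr_ae_μI (h0 : 0 ≤ t) (ht : t ≤ T) (h : f =ᵐ[μI T] g) :
    ∫ τ in (0 : ℝ)..t, f τ = ∫ τ in (0 : ℝ)..t, g τ := by
  rw [intervalIntegral.integral_of_le h0, intervalIntegral.integral_of_le h0,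
    integral_Ioc_eq_integral_Ioo, integral_Ioc_eq_integral_Ioo]
  exact integral_congr_ae (ae_restrict_of_ae_restrict_of_subset (Ioo_subset_Ioo_right ht) h)

/-- The functional `u ↦ ∫₀ᵗ u` on `L²((0, T), ℝ)`, for `t ≤ T`. -/
def primL (T t : ℝ) : L2 T →L[ℝ] ℝ :=
  innerSL ℝ (indicatorConstLp 2 (measurableSet_Ioo (a := (0 : ℝ)) (b := t))
    (measure_ne_top (μI T) _) (1 : ℝ))

theorem primL_apply (h0 : 0 ≤ t) (ht : t ≤ T) (u : L2 T) :
    primL T t u = ∫ τ in (0 : ℝ)..t, u τ := by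
  rw [primL, innerSL_apply_apply, L2.inner_indicatorConstLp_one,
    intervalIntegral.integral_of_le h0, integral_Ioc_eq_integral_Ioo,
    Measure.restrict_restrict measurableSet_Ioo, inter_eq_left.mpr (Ioo_subset_Ioo_right ht)]

theorem norm_primL_le (hT : 0 ≤ T) (t : ℝ) (u : L2 T) : ‖primL T t u‖ ≤ Real.sqrt T * ‖u‖ := by
  refine (norm_inner_le_norm (𝕜 := ℝ) _ u).trans (mul_le_mul_of_nonneg_right ?_ (norm_nonneg u))
  rw [norm_indicatorConstLp (by norm_num) (by norm_num), norm_one, one_mul, Real.sqrt_eq_rpow,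
    ENNReal.toReal_ofNat]
  gcongr
  refine (measureReal_mono (subset_univ _)).trans ?_
  simp [measureReal_def, hT]

theorem memLp_primL (hT : 0 ≤ T) (u : L2 T) : MemLp (fun t => primL T t u) 2 (μI T) := by
  refine MemLp.of_bound ?_ (Real.sqrt T * ‖u‖) (Eventually.of_forall fun t => norm_primL_le hT t u)
  have hcont : ContinuousOn (fun t => ∫ τ in (0 : ℝ)..t, u τ) (Icc 0 T) := by
    rw [← uIcc_of_le hT]
    refine intervalIntegral.continuousOn_primitive_interval ?_
    rw [uIcc_of_le hT, integrableOn_Icc_iff_integrableOn_Ioo]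
    exact memLp_one_iff_integrable.mp ((Lp.memLp u).mono_exponent one_le_two)
  exact ((hcont.mono Ioo_subset_Icc_self).congr fun t ht =>
    primL_apply ht.1.le ht.2.le u).aestronglyMeasurable measurableSet_Ioo

/-- The Volterra operator `u ↦ (t ↦ ∫₀ᵗ u)` on `L²((0, T), ℝ)`. -/
def volterra (hT : 0 ≤ T) : L2 T →L[ℝ] L2 T :=
  LinearMap.mkContinuous
    { toFun := fun u => (memLp_primL hT u).toLp
      map_add' := fun u v => by
        rw [← MemLp.toLp_add]
        exact MemLp.toLp_congr _ _ (Eventually.of_forall fun t => map_add (primL T t) u v)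
      map_smul' := fun r u => by
        rw [RingHom.id_apply, ← MemLp.toLp_const_smul]
        exact MemLp.toLp_congr _ _ (Eventually.of_forall fun t => map_smul (primL T t) r u) }
    ((measureUnivNNReal (μI T) : ℝ) ^ ((2 : ℝ≥0∞).toReal)⁻¹ * Real.sqrt T) fun u => by
      rw [mul_assoc]
      refine Lp.norm_le_of_ae_bound (by positivity) ?_
      filter_upwards [(memLp_primL hT u).coeFn_toLp] with t ht
      exact (congrArg norm ht).trans_le (norm_primL_le hT t u)

theorem coeFn_volterra (hT : 0 ≤ T) (u : L2 T) :
    volterra hT u =ᵐ[μI T] fun t => ∫ τ in (0 : ℝ)..t, u τ := by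
  filter_upwards [(memLp_primL hT u).coeFn_toLp, ae_restrict_mem measurableSet_Ioo] with t ht htT
  exact ht.trans (primL_apply htT.1.le htT.2.le u)

theorem volterra_pow_succ (hT : 0 ≤ T) (n : ℕ) (u : L2 T) :
    (volterra hT ^ (n + 1)) u = volterra hT ((volterra hT ^ n) u) := by
  rw [pow_succ']
  rfl

theorem iterPrim_ae_eq (hT : 0 ≤ T) (u : L2 T) (n : ℕ) :
    iterPrim u n =ᵐ[μI T] (volterra hT ^ n) u := by
  induction n with
  | zero => exact ae_eq_refl _
  | succ n ih =>
    filter_upwards [coeFn_volterra hT ((volterra hT ^ n) u), ae_restrict_mem measurableSet_Ioo]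
      with t ht htT
    rw [volterra_pow_succ, ht]
    exact intervalIntegral_congr_ae_μI htT.1.le htT.2.le ih

theorem iterPrim_succ_apply (hT : 0 ≤ T) (u : L2 T) (n : ℕ) :
    iterPrim u (n + 1) T = primL T T ((volterra hT ^ n) u) := by
  rw [primL_apply hT le_rfl]
  exact intervalIntegral_congr_ae_μI hT le_rfl (iterPrim_ae_eq hT u n)

theorem negNorm_eq (hT : 0 ≤ T) (u : L2 T) (n : ℕ) :
    negNorm T n u = |primL T T u| + ‖(volterra hT ^ n) u‖ := by
  have hnorm : ∫ t in (0 : ℝ)..T, iterPrim u n t ^ 2 = ‖(volterra hT ^ n) u‖ ^ 2 := by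
    rw [intervalIntegral.integral_of_le hT, integral_Ioc_eq_integral_Ioo,
      ← real_inner_self_eq_norm_sq, L2.inner_def]
    apply integral_congr_ae
    filter_upwards [iterPrim_ae_eq hT u n] with t ht
    rw [ht, real_inner_self_eq_norm_sq, Real.norm_eq_abs, sq_abs]
  rw [negNorm, hnorm, Real.sqrt_sq (norm_nonneg _), iterPrim_succ_apply hT]
  rfl

theorem realMomentL_zero (hT : 0 ≤ T) (u : L2 T) : realMomentL T 0 u = primL T T u := by
  rw [realMomentL_apply, primL_apply hT le_rfl, intervalIntegral.integral_of_le hT,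
    integral_Ioc_eq_integral_Ioo, ← integral_complex_ofReal]
  simp [expI]

theorem IsTestFun.volterra_toL2_deriv (hT : 0 ≤ T) (hf : IsTestFun T f) :
    volterra hT hf.deriv.toL2 = hf.toL2 := by
  apply Lp.ext
  filter_upwards [coeFn_volterra hT hf.deriv.toL2, hf.coeFn_toL2,
    ae_restrict_mem measurableSet_Ioo] with t h1 h2 htT
  rw [h1, h2, intervalIntegral_congr_ae_μI htT.1.le htT.2.le hf.deriv.coeFn_toL2,
    hf.intervalIntegral_deriv]

theorem IsTestFun.primL_toL2_deriv (hT : 0 ≤ T) (hf : IsTestFun T f) :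
    primL T T hf.deriv.toL2 = 0 := by
  rw [primL_apply hT le_rfl, intervalIntegral_congr_ae_μI hT le_rfl hf.deriv.coeFn_toL2,
    hf.intervalIntegral_deriv, hf.apply_eq_zero (by simp)]

theorem IsTestFun.inner_toL2_deriv (hf : IsTestFun T f) (hg : IsTestFun T g) :
    inner ℝ hf.deriv.toL2 hg.toL2 = -inner ℝ hf.toL2 hg.deriv.toL2 := by
  have hderiv : _root_.deriv (f * g) = _root_.deriv f * g + f * _root_.deriv g :=
    funext fun t => ((hf.hasDerivAt t).mul (hg.hasDerivAt t)).deriv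
  have hint := (hf.mul_contDiff hg.smooth).integral_deriv
  rw [hderiv, integral_add' (hf.deriv.mul_contDiff hg.smooth).integrable
    (hf.mul_contDiff hg.deriv.smooth).integrable] at hint
  rw [IsTestFun.inner_toL2, IsTestFun.inner_toL2, star_trivial, star_trivial]
  exact eq_neg_of_add_eq_zero_left hint

theorem IsTestFun.inner_toL2_iteratedDeriv (hf : IsTestFun T f) (hg : IsTestFun T g) (n : ℕ) :
    inner ℝ (hf.iteratedDeriv n).toL2 hg.toL2 =
      (-1) ^ n * inner ℝ hf.toL2 (hg.iteratedDeriv n).toL2 := by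
  induction n generalizing f with
  | zero => simp [IsTestFun.toL2]
  | succ n ih =>
    rw [IsTestFun.toL2_congr _ (hf.deriv.iteratedDeriv n) iteratedDeriv_succ', ih hf.deriv,
      hf.inner_toL2_deriv, pow_succ, mul_neg_one, neg_mul, mul_neg,
      (hg.iteratedDeriv (n + 1)).toL2_congr (hg.iteratedDeriv n).deriv iteratedDeriv_succ]

end Volterra

/-! ### Series of test functions in Sobolev spaces -/

section TestSeries

variable {T : ℝ} {ι : Type*} {s k : ℕ} {φ : ι → ℝ → ℝ} {c : ℕ → L2 T}

/-- A series of test functions that converges in `L²(0, T)` together with its derivatives of order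
at most `s`; `c q` is the sum of the series of the derivatives of order `q`. -/
structure IsTestSeries (T : ℝ) (s : ℕ) (φ : ι → ℝ → ℝ) (c : ℕ → L2 T) : Prop where
  isTestFun : ∀ i, IsTestFun T (φ i)
  hasSum : ∀ q ≤ s, HasSum (fun i => ((isTestFun i).iteratedDeriv q).toL2) (c q)

theorem IsTestFun.isTestSeries {φ : ℝ → ℝ} (hφ : IsTestFun T φ) (s : ℕ) :
    IsTestSeries T s (fun _ : Unit => φ) fun q => (hφ.iteratedDeriv q).toL2 :=
  ⟨fun _ => hφ, fun _ _ => hasSum_unique _⟩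

namespace IsTestSeries

theorem shift {r : ℕ} (hc : IsTestSeries T (r + s) φ c) :
    IsTestSeries T s (fun i => iteratedDeriv r (φ i)) fun q => c (r + q) := by
  refine ⟨fun i => (hc.isTestFun i).iteratedDeriv r, fun q hq => ?_⟩
  refine (hc.hasSum (r + q) (by omega)).congr_fun fun i => IsTestFun.toL2_congr _ _ ?_
  rw [iteratedDeriv_eq_iterate, iteratedDeriv_eq_iterate, iteratedDeriv_eq_iterate, add_comm,
    Function.iterate_add_apply]

theorem hasSum_succ {q : ℕ} (hc : IsTestSeries T s φ c) (hq : q < s) :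
    HasSum (fun i => ((hc.isTestFun i).iteratedDeriv q).deriv.toL2) (c (q + 1)) :=
  (hc.hasSum (q + 1) hq).congr_fun fun _ => IsTestFun.toL2_congr _ _ iteratedDeriv_succ.symm

theorem volterra_pow_apply (hT : 0 ≤ T) (hc : IsTestSeries T s φ c) {q n : ℕ} (hq : q + n ≤ s) :
    (volterra hT ^ n) (c (q + n)) = c q := by
  induction n generalizing q with
  | zero => rfl
  | succ n ih =>
    rw [volterra_pow_succ, ← add_assoc, add_right_comm, ih (by omega)]
    refine ((hc.hasSum_succ (by omega)).mapL (volterra hT)).unique ?_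
    exact (hc.hasSum q (by omega)).congr_fun fun i =>
      ((hc.isTestFun i).iteratedDeriv q).volterra_toL2_deriv hT

theorem primL_succ_eq_zero (hT : 0 ≤ T) (hc : IsTestSeries T s φ c) {q : ℕ} (hq : q < s) :
    primL T T (c (q + 1)) = 0 := by
  refine ((hc.hasSum_succ hq).mapL (primL T T)).unique ?_
  exact hasSum_zero.congr_fun fun i => ((hc.isTestFun i).iteratedDeriv q).primL_toL2_deriv hT

theorem isWeakDeriv (hc : IsTestSeries T s φ c) {n : ℕ} (hn : n ≤ s) :
    IsWeakDeriv T n (c 0) (c n) := by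
  intro ψ hψ
  have hinner : ∀ {g : ℝ → ℝ} (hg : IsTestFun T g) (u : L2 T),
      ∫ t in Ioo 0 T, u t * g t = inner ℝ hg.toL2 u := fun hg u => by
    rw [L2.inner_def]
    apply integral_congr_ae
    filter_upwards [hg.coeFn_toL2] with t ht
    rw [ht, RCLike.inner_apply, conj_trivial]
  rw [hinner (hψ.isTestFun.iteratedDeriv n), hinner hψ.isTestFun]
  have h0 := (hc.hasSum 0 s.zero_le).mapL (innerSL ℝ (hψ.isTestFun.iteratedDeriv n).toL2)
  have hn := ((hc.hasSum n hn).mapL (innerSL ℝ hψ.isTestFun.toL2)).mul_left ((-1) ^ n)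
  refine h0.unique (hn.congr_fun fun i => ?_)
  rw [innerSL_apply_apply, innerSL_apply_apply,
    ← hψ.isTestFun.inner_toL2_iteratedDeriv (hc.isTestFun i),
    (hc.isTestFun i).toL2_congr _ iteratedDeriv_zero.symm]

/-- The element `(c 0, …, c k)` of `H^k(0, T)`. -/
def toSobolevH (hc : IsTestSeries T k φ c) : SobolevH k T :=
  ⟨WithLp.toLp 2 fun n => c n, fun n => hc.isWeakDeriv (by omega)⟩

theorem hasSum_toSobolevH (hc : IsTestSeries T k φ c) :
    HasSum (fun i => ((hc.isTestFun i).isTestSeries k).toSobolevH) hc.toSobolevH := by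
  refine (IsInducing.hasSum_iff (g := (SobolevH k T).subtype) IsInducing.subtypeVal _ _).mp ?_
  have hpi : HasSum (fun i (n : Fin (k + 1)) => ((hc.isTestFun i).iteratedDeriv n).toL2)
      fun n => c n := Pi.hasSum.mpr fun n => hc.hasSum n (by omega)
  exact hpi.mapL (PiLp.continuousLinearEquiv 2 ℝ
    fun _ : Fin (k + 1) => L2 T).symm.toContinuousLinearMap

theorem toSobolevH_mem (hc : IsTestSeries T k φ c) : hc.toSobolevH ∈ SobolevH0 k T := by
  refine (Submodule.isClosed_topologicalClosure _).mem_of_tendsto hc.hasSum_toSobolevH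
    (Eventually.of_forall fun F => Submodule.sum_mem _ fun i _ =>
      Submodule.le_topologicalClosure _ ⟨φ i, (hc.isTestFun i).isTest, ?_⟩)
  simpa only [iteratedDeriv_zero] using! ((hc.isTestFun i).iteratedDeriv 0).coeFn_toL2

end IsTestSeries

/-- The operator with values in `H^k_0(0, T)` whose weak derivatives are the operators `c n`. -/
def clmSobolevH0 {E : Type*} [SeminormedAddCommGroup E] [NormedSpace ℝ E] (c : ℕ → E →L[ℝ] L2 T)
    (hc : ∀ e, ∃ φ : ι → ℝ → ℝ, IsTestSeries T k φ fun n => c n e) : E →L[ℝ] SobolevH0 k T :=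
  let V : E →L[ℝ] PiLp 2 (fun _ : Fin (k + 1) => L2 T) :=
    (PiLp.continuousLinearEquiv 2 ℝ fun _ : Fin (k + 1) => L2 T).symm.toContinuousLinearMap.comp
      (ContinuousLinearMap.pi fun n => c n)
  (V.codRestrict (SobolevH k T) fun e => (hc e).choose_spec.toSobolevH.2).codRestrict
    (SobolevH0 k T) fun e => (hc e).choose_spec.toSobolevH_mem

end TestSeries

/-! ### Real solutions in Sobolev spaces -/

section RealSolutions

variable {ι : Type*} [DecidableEq ι] {lam : ι → ℝ} {T : ℝ} {σ : ℝ → ℂ}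

namespace SparseFreq

theorem momentL_solver (h : SparseFreq lam) (hσ : IsWindow T σ) {s q : ℕ} (hq : q ≤ s)
    (z : Ell2 ι) (l : ι) : momentL T (lam l) (h.solver hσ s q z) =
      (-(Complex.I * lam l)) ^ q * (((lam l : ℂ) ^ s)⁻¹ * z l) := by
  refine ((h.hasSum_solver hσ hq z).mapL (momentL T (lam l))).unique ?_
  refine ((h.hasSum_hat_solver hσ s z l).mul_left _).congr_fun fun i => ?_
  rw [map_smul, momentL_toL2, hat_iteratedDeriv (hσ.mul_self.mode _), smul_eq_mul, mul_left_comm]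

theorem exists_isTestSeries_solver (h : SparseFreq lam) (hσ : IsWindow T σ) (s : ℕ)
    (z : Ell2 ι) :
    ∃ φ : ι → ℝ → ℝ, IsTestSeries T s φ fun q => reL T (h.solver hσ s q z) := by
  set a : Ell2 ι := (h.invOp ^ s) (Ring.inverse (gramOp T lam (σ * σ) s) z)
  let L : ι → ℂ →L[ℝ] ℝ := fun i => Complex.reCLM.comp (ContinuousLinearMap.mul ℝ ℂ (a i))
  have hmode : ∀ i, IsTestFun T (mode (σ * σ) (lam i)) := fun i => hσ.mul_self.mode (lam i)
  refine ⟨fun i => L i ∘ mode (σ * σ) (lam i), fun i => (hmode i).clm_comp (L i), fun q hq => ?_⟩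
  refine ((h.hasSum_solver hσ hq z).mapL (reL T)).congr_fun fun i => ?_
  rw [IsTestFun.toL2_congr _ (((hmode i).iteratedDeriv q).clm_comp (L i))
    ((hmode i).iteratedDeriv_clm_comp (L i) q), ← ((hmode i).iteratedDeriv q).compLp_toL2 (L i)]
  apply Lp.ext
  filter_upwards [(L i).coeFn_compLp ((hmode i).iteratedDeriv q).toL2, coeFn_reL _,
    Lp.coeFn_smul (a i) ((hmode i).iteratedDeriv q).toL2] with t hL hre hsmul
  rw [hL, hre, hsmul]
  rfl

theorem exists_isTestSeries_derivative_solver (h : SparseFreq lam) (hσ : IsWindow T σ) (r s : ℕ)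
    (z : Ell2 ι) :
    ∃ φ : ι → ℝ → ℝ, IsTestSeries T s φ fun q => reL T (h.solver hσ (r + s) (r + q) z) :=
  (h.exists_isTestSeries_solver hσ (r + s) z).imp' _ fun _ hφ => hφ.shift

/-- The operator with values in `H^k_0(0, T)` that sends `z` to the real part of the `(k + 1)`-st
derivative of a series of modes. Differentiating `k + 1` times is what makes the iterated
primitives of order at most `k + 1` vanish at `T`. -/
def solverH0 (h : SparseFreq lam) (hσ : IsWindow T σ) (k : ℕ) : Ell2 ι →L[ℝ] SobolevH0 k T :=
  clmSobolevH0
    (fun m => (reL T).comp ((h.solver hσ (k + 1 + k) (k + 1 + m)).restrictScalars ℝ))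
    fun z => h.exists_isTestSeries_derivative_solver hσ (k + 1) k z

variable {k : ℕ}

theorem wderiv_solverH0 (h : SparseFreq lam) (hσ : IsWindow T σ) (z : Ell2 ι) (m : Fin (k + 1)) :
    SobolevH0.wderiv (h.solverH0 hσ k z) m = reL T (h.solver hσ (k + 1 + k) (k + 1 + m) z) := rfl

theorem volterra_pow_solverH0 (h : SparseFreq lam) (hσ : IsWindow T σ) (hT : 0 ≤ T) (z : Ell2 ι)
    {n : ℕ} (hn : n ≤ k + 1) :
    (volterra hT ^ n) (SobolevH0.wderiv (h.solverH0 hσ k z) 0) =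
      reL T (h.solver hσ (k + 1 + k) (k + 1 - n) z) := by
  obtain ⟨φ, hφ⟩ := h.exists_isTestSeries_solver hσ (k + 1 + k) z
  have hprim := hφ.volterra_pow_apply hT (q := k + 1 - n) (n := n) (by omega)
  rwa [Nat.sub_add_cancel hn] at hprim

theorem primL_volterra_pow_solverH0 (h : SparseFreq lam) (hσ : IsWindow T σ) (hT : 0 ≤ T)
    (z : Ell2 ι) {n : ℕ} (hn : n ≤ k) :
    primL T T ((volterra hT ^ n) (SobolevH0.wderiv (h.solverH0 hσ k z) 0)) = 0 := by
  obtain ⟨φ, hφ⟩ := h.exists_isTestSeries_solver hσ (k + 1 + k) z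
  rw [h.volterra_pow_solverH0 hσ hT z (by omega), Nat.sub_add_comm hn]
  exact hφ.primL_succ_eq_zero hT (by omega)

theorem exists_norm_wderiv_solverH0_le (h : SparseFreq lam) (hσ : IsWindow T σ)
    (m : Fin (k + 1)) :
    ∃ C : ℝ, ∀ z, ‖SobolevH0.wderiv (h.solverH0 hσ k z) m‖ ≤ C * ‖(h.invOp ^ (k - m : ℕ)) z‖ := by
  obtain ⟨C, hC⟩ := h.exists_norm_solver_le hσ (show k + 1 + m ≤ k + 1 + k by omega)
  rw [Nat.add_sub_add_left] at hC
  exact ⟨C, fun z => (norm_reL_le _).trans (hC z)⟩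

theorem exists_norm_volterra_pow_solverH0_le (h : SparseFreq lam) (hσ : IsWindow T σ)
    (hT : 0 ≤ T) {n : ℕ} (hn : n ≤ k + 1) :
    ∃ C : ℝ, ∀ z, ‖(volterra hT ^ n) (SobolevH0.wderiv (h.solverH0 hσ k z) 0)‖ ≤
      C * ‖(h.invOp ^ (k + n)) z‖ := by
  obtain ⟨C, hC⟩ := h.exists_norm_solver_le hσ (show k + 1 - n ≤ k + 1 + k by omega)
  rw [show k + 1 + k - (k + 1 - n) = k + n by omega] at hC
  refine ⟨C, fun z => ?_⟩
  rw [h.volterra_pow_solverH0 hσ hT z hn]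
  exact (norm_reL_le _).trans (hC z)

theorem realMomentL_solverH0 (h : SparseFreq lam) (hσ : IsWindow T σ) {z : Ell2 ι} {l l' : ι}
    (hl : lam l' = -lam l) (hz : z l' = 0) :
    realMomentL T (lam l) (SobolevH0.wderiv (h.solverH0 hσ k z) 0) =
      (-Complex.I) ^ (k + 1) * (((lam l : ℂ) ^ k)⁻¹ * z l) / 2 := by
  have hq : k + 1 ≤ k + 1 + k := by omega
  rw [wderiv_solverH0, Fin.val_zero, add_zero, realMomentL_reL, ← hl, h.momentL_solver hσ hq,
    h.momentL_solver hσ hq, hz, mul_zero, mul_zero, star_zero, add_zero]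
  have hne := h.ofReal_ne_zero l
  field_simp
  ring

end SparseFreq

end RealSolutions

/-! ### Two-sided frequencies -/

section TwoSided

variable {ω : ℕ → ℝ}

/-- The two-sided sequence `±ω_{j+1}`. -/
def twoSided (ω : ℕ → ℝ) : ℕ ⊕ ℕ → ℝ := Sum.elim (fun j => ω (j + 1)) fun j => -ω (j + 1)

theorem summable_sum_prod_sum {α β : Type*} {f : (α ⊕ β) × (α ⊕ β) → ℝ}
    (h₁₁ : Summable fun p : α × α => f (Sum.inl p.1, Sum.inl p.2))
    (h₁₂ : Summable fun p : α × β => f (Sum.inl p.1, Sum.inr p.2))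
    (h₂₁ : Summable fun p : β × α => f (Sum.inr p.1, Sum.inl p.2))
    (h₂₂ : Summable fun p : β × β => f (Sum.inr p.1, Sum.inr p.2)) : Summable f := by
  rw [← (Equiv.sumProdDistrib α β (α ⊕ β)).symm.summable_iff]
  refine Summable.sum _ ?_ ?_
  · rw [← (Equiv.prodSumDistrib α α β).symm.summable_iff]
    exact Summable.sum _ h₁₁ h₁₂
  · rw [← (Equiv.prodSumDistrib β α β).symm.summable_iff]
    exact Summable.sum _ h₂₁ h₂₂

theorem inv_add_pow_le_of_strictMono (hω : StrictMono ω) (h0 : ω 0 = 0) (M i j : ℕ) :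
    ((ω (i + 1) + ω (j + 1))⁻¹) ^ M ≤
      (|ω i - ω (j + 1)|⁻¹) ^ M + (|ω (i + 1) - ω j|⁻¹) ^ M := by
  have hnonneg : ∀ n, 0 ≤ ω n := fun n => h0 ▸ hω.monotone n.zero_le
  have hpos : ∀ {m n}, m ≤ n → 0 < ω (n + 1) - ω m := fun hmn => sub_pos.mpr (hω (by omega))
  have hsum : 0 ≤ (ω (i + 1) + ω (j + 1))⁻¹ := inv_nonneg.mpr (add_nonneg (hnonneg _) (hnonneg _))
  rcases le_total i j with hij | hji
  · refine le_add_of_le_of_nonneg ?_ (by positivity)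
    rw [abs_sub_comm, abs_of_pos (hpos hij)]
    exact pow_le_pow_left₀ hsum
      (inv_anti₀ (hpos hij) (by linarith [hnonneg i, hnonneg (i + 1)])) M
  · refine le_add_of_nonneg_of_le (by positivity) ?_
    rw [abs_of_pos (hpos hji)]
    exact pow_le_pow_left₀ hsum
      (inv_anti₀ (hpos hji) (by linarith [hnonneg j, hnonneg (j + 1)])) M

theorem powSeparated_twoSided (h : PowSeparated ω) (hω : StrictMono ω) (h0 : ω 0 = 0) :
    PowSeparated (twoSided ω) := by
  obtain ⟨M, hM⟩ := h
  have hpos : ∀ n, 0 < ω (n + 1) := fun n => h0 ▸ hω n.succ_pos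
  have hid : Function.Injective fun j : ℕ => j := Function.injective_id
  have hsucc : Function.Injective fun j : ℕ => j + 1 := add_left_injective 1
  have hsame : Summable fun p : ℕ × ℕ => (|ω (p.1 + 1) - ω (p.2 + 1)|⁻¹) ^ M := by
    simpa [Function.comp_def] using hM.comp_injective (hsucc.prodMap hsucc)
  have hleft : Summable fun p : ℕ × ℕ => (|ω p.1 - ω (p.2 + 1)|⁻¹) ^ M := by
    simpa [Function.comp_def] using hM.comp_injective (hid.prodMap hsucc)
  have hright : Summable fun p : ℕ × ℕ => (|ω (p.1 + 1) - ω p.2|⁻¹) ^ M := by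
    simpa [Function.comp_def] using hM.comp_injective (hsucc.prodMap hid)
  have hopp : Summable fun p : ℕ × ℕ => ((ω (p.1 + 1) + ω (p.2 + 1))⁻¹) ^ M :=
    (hleft.add hright).of_nonneg_of_le
      (fun p => pow_nonneg (inv_nonneg.mpr (add_pos (hpos _) (hpos _)).le) _)
      fun p => inv_add_pow_le_of_strictMono hω h0 M p.1 p.2
  refine ⟨M, summable_sum_prod_sum ?_ ?_ ?_ ?_⟩ <;>
    simp only [twoSided, Sum.elim_inl, Sum.elim_inr, sub_neg_eq_add, ← neg_add',
      abs_neg, abs_of_pos (add_pos (hpos _) (hpos _))]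
  exacts [hsame, hopp, hopp, hsame.congr fun p => by rw [abs_sub_comm, ← neg_add_eq_sub]]

theorem sparseFreq_twoSided (hω : StrictMono ω) (h0 : ω 0 = 0) (h : PowSeparated ω) :
    SparseFreq (twoSided ω) := by
  have hpos : ∀ n, 0 < ω (n + 1) := fun n => h0 ▸ hω n.succ_pos
  have hinj : Function.Injective fun n => ω (n + 1) := hω.injective.comp Nat.succ_injective
  refine ⟨hinj.sumElim (neg_injective.comp hinj) fun i j =>
    ((neg_neg_of_pos (hpos j)).trans (hpos i)).ne', ⟨ω 1, hpos 0, ?_⟩,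
    powSeparated_twoSided h hω h0⟩
  rintro (i | i)
  · exact (hω.monotone (by omega)).trans (le_abs_self _)
  · exact (hω.monotone (by omega)).trans ((le_abs_self _).trans_eq (abs_neg _).symm)

theorem AsymptGapPoly.exists_inv_sub_succ_le (h : AsymptGapPoly ω) :
    ∃ ε > 0, ∃ K : ℝ, ∀ j : ℕ, ((j : ℝ) + 2) ^ (ε : ℝ) * (ω (j + 1) - ω j)⁻¹ ≤ K := by
  obtain ⟨ε, hε, N, c, hc, hgap⟩ := h
  have hbdd : ∀ j ≥ max N 1, ((j : ℝ) + 2) ^ ε * (ω (j + 1) - ω j)⁻¹ ≤ 3 ^ ε * c⁻¹ := by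
    intro j hj
    have hj1 : (1 : ℝ) ≤ j := by exact_mod_cast (le_max_right N 1).trans hj
    have hcj : 0 < c * (j : ℝ) ^ ε := by positivity
    calc ((j : ℝ) + 2) ^ ε * (ω (j + 1) - ω j)⁻¹ ≤ (3 * j) ^ ε * (c * (j : ℝ) ^ ε)⁻¹ := by
          have hle := hgap j ((le_max_left N 1).trans hj)
          gcongr
          · exact inv_nonneg.mpr (hcj.le.trans hle)
          · linarith
      _ = 3 ^ ε * c⁻¹ := by
          rw [Real.mul_rpow (by norm_num) (by positivity)]
          field_simp
  obtain ⟨K, hK⟩ := (isBoundedUnder_of_eventually_le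
    ((eventually_ge_atTop (max N 1)).mono hbdd)).bddAbove_range
  exact ⟨ε, hε, K, fun j => hK ⟨j, rfl⟩⟩

theorem AsymptGapPoly.exists_inv_abs_sub_le (h : AsymptGapPoly ω) (hω : StrictMono ω) :
    ∃ ε > 0, ∃ K : ℝ, ∀ i j : ℕ,
      |ω i - ω j|⁻¹ ≤ K * ((((i : ℝ) + 1) * (j + 1)) ^ (ε : ℝ))⁻¹ := by
  obtain ⟨ε, hε, K, hK⟩ := h.exists_inv_sub_succ_le
  have hK0 : 0 ≤ K := le_trans
    (mul_nonneg (by positivity) (inv_nonneg.mpr (sub_pos.mpr (hω (Nat.lt_succ_self 0))).le)) (hK 0)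
  have hlt : ∀ i j : ℕ, i ≤ j →
      |ω i - ω (j + 1)|⁻¹ ≤ K * ((((i : ℝ) + 1) * ((j + 1 : ℕ) + 1)) ^ (ε / 2))⁻¹ := by
    intro i j hij
    have hgap : 0 < ω (j + 1) - ω j := sub_pos.mpr (hω (Nat.lt_succ_self j))
    have hij' : (i : ℝ) ≤ j := by exact_mod_cast hij
    have hprod : (((i : ℝ) + 1) * ((j + 1 : ℕ) + 1)) ^ (ε / 2) ≤ ((j : ℝ) + 2) ^ ε := by
      calc (((i : ℝ) + 1) * ((j + 1 : ℕ) + 1)) ^ (ε / 2)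
          ≤ (((j : ℝ) + 2) ^ (2 : ℝ)) ^ (ε / 2) := by
            gcongr
            rw [Real.rpow_two]
            push_cast
            nlinarith
        _ = ((j : ℝ) + 2) ^ ε := by
            rw [← Real.rpow_mul (by positivity), mul_div_cancel₀ ε two_ne_zero]
    calc |ω i - ω (j + 1)|⁻¹ ≤ (ω (j + 1) - ω j)⁻¹ := by
          gcongr
          rw [abs_sub_comm]
          exact (sub_le_sub_left (hω.monotone hij) _).trans (le_abs_self _)
      _ ≤ K * (((j : ℝ) + 2) ^ ε)⁻¹ := by
          rw [← div_eq_mul_inv, le_div_iff₀' (by positivity)]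
          exact hK j
      _ ≤ _ := by gcongr
  refine ⟨ε / 2, by positivity, K, fun i j => ?_⟩
  rcases lt_trichotomy i j with hij | rfl | hji
  · obtain ⟨j, rfl⟩ := Nat.exists_eq_add_of_lt hij
    exact hlt i (i + j) (by omega)
  · rw [sub_self, abs_zero, inv_zero]
    positivity
  · obtain ⟨i, rfl⟩ := Nat.exists_eq_add_of_lt hji
    rw [abs_sub_comm, mul_comm (((j + i + 1 : ℕ) : ℝ) + 1)]
    exact hlt j (j + i) (by omega)

theorem AsymptGapPoly.powSeparated (h : AsymptGapPoly ω) (hω : StrictMono ω) :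
    PowSeparated ω := by
  obtain ⟨ε, hε, K, hK⟩ := h.exists_inv_abs_sub_le hω
  obtain ⟨M, hM⟩ := exists_nat_ge (2 / ε)
  have hM2 : 2 ≤ ε * M := (div_le_iff₀' hε).mp hM
  have hsq : Summable fun j : ℕ => (((j : ℝ) + 1) ^ 2)⁻¹ := by
    simpa using (summable_nat_add_iff 1).mpr (Real.summable_nat_pow_inv.mpr one_lt_two)
  have hnonneg : 0 ≤ fun j : ℕ => (((j : ℝ) + 1) ^ 2)⁻¹ := fun j => by positivity
  refine ⟨M, Summable.of_nonneg_of_le (fun _ => by positivity) (fun p => ?_)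
    ((hsq.mul_of_nonneg hsq hnonneg hnonneg).mul_left (K ^ M))⟩
  set Q := ((p.1 : ℝ) + 1) * (p.2 + 1) with hQ
  have hQ1 : 1 ≤ Q := one_le_mul_of_one_le_of_one_le (by simp) (by simp)
  have hK0 : 0 ≤ K := nonneg_of_mul_nonneg_left
    ((inv_nonneg.mpr (abs_nonneg _)).trans (hK p.1 p.2)) (by positivity)
  calc (|ω p.1 - ω p.2|⁻¹) ^ M ≤ (K * (Q ^ ε)⁻¹) ^ M := by
        gcongr
        exact hK _ _
    _ = K ^ M * (Q ^ (ε * M))⁻¹ := by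
        rw [mul_pow, inv_pow, ← Real.rpow_mul_natCast (by positivity)]
    _ ≤ K ^ M * (Q ^ (2 : ℝ))⁻¹ := by gcongr
    _ = _ := by rw [hQ, Real.rpow_two, mul_pow, mul_inv]

end TwoSided

/-! ### Data on the nonzero frequencies -/

section OneSided

theorem hasSum_norm_sq_sumElim (x : Ell2 ℕ) :
    HasSum (fun i => ‖Sum.elim (fun j => x (j + 1)) (0 : ℕ → ℂ) i‖ ^ 2) (‖x‖ ^ 2 - ‖x 0‖ ^ 2) := by
  have hinl : HasSum (fun j => ‖x (j + 1)‖ ^ 2) (‖x‖ ^ 2 - ‖x 0‖ ^ 2) := by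
    simpa using (hasSum_nat_add_iff' 1).mpr (Ell2.hasSum_norm_sq x)
  have hinr : HasSum (fun _ : ℕ => ‖(0 : ℂ)‖ ^ 2) 0 := by simp
  rw [← add_zero (‖x‖ ^ 2 - ‖x 0‖ ^ 2)]
  exact HasSum.sum hinl hinr

theorem memℓp_sumElim (x : Ell2 ℕ) : Memℓp (Sum.elim (fun j => x (j + 1)) (0 : ℕ → ℂ)) 2 :=
  memℓp_gen (by simpa using (hasSum_norm_sq_sumElim x).summable)

theorem norm_le_of_eq_sumElim {x : Ell2 ℕ} {y : Ell2 (ℕ ⊕ ℕ)}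
    (h : (y : ℕ ⊕ ℕ → ℂ) = Sum.elim (fun j => x (j + 1)) 0) : ‖y‖ ≤ ‖x‖ := by
  have hy := Ell2.hasSum_norm_sq y
  rw [h] at hy
  rw [← sq_le_sq₀ (norm_nonneg _) (norm_nonneg _), hy.unique (hasSum_norm_sq_sumElim x)]
  exact sub_le_self _ (by positivity)

/-- The operator that forgets `x 0`, puts the other coordinates of `x` at the frequencies
`ω_{j+1}`, and puts `0` at the opposite frequencies `-ω_{j+1}`. -/
def twoSidedData : Ell2 ℕ →L[ℂ] Ell2 (ℕ ⊕ ℕ) :=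
  LinearMap.mkContinuous
    { toFun := fun x => ⟨Sum.elim (fun j => x (j + 1)) 0, memℓp_sumElim x⟩
      map_add' := fun _ _ => lp.ext (funext (Sum.rec (fun _ => rfl) fun _ => (add_zero 0).symm))
      map_smul' := fun c _ => lp.ext (funext (Sum.rec (fun _ => rfl) fun _ => (mul_zero c).symm)) }
    1 fun x => (norm_le_of_eq_sumElim rfl).trans_eq (one_mul ‖x‖).symm

theorem twoSidedData_inl (x : Ell2 ℕ) (j : ℕ) : twoSidedData x (Sum.inl j) = x (j + 1) := rfl

theorem twoSidedData_inr (x : Ell2 ℕ) (j : ℕ) : twoSidedData x (Sum.inr j) = 0 := rfl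

theorem norm_twoSidedData_le (x : Ell2 ℕ) : ‖twoSidedData x‖ ≤ ‖x‖ := norm_le_of_eq_sumElim rfl

variable {ω : ℕ → ℝ} {T : ℝ} {σ : ℝ → ℂ}

theorem invOp_pow_twoSidedData (h : SparseFreq (twoSided ω)) {p : ℕ} {x x' : Ell2 ℕ}
    (hx : ∀ j, x (j + 1) = (ω (j + 1) : ℂ) ^ p * x' (j + 1)) :
    (h.invOp ^ p) (twoSidedData x) = twoSidedData x' := by
  ext (j | j)
  · rw [h.invOp_pow_apply, twoSidedData_inl, twoSidedData_inl, hx]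
    exact inv_mul_cancel_left₀ (pow_ne_zero p (h.ofReal_ne_zero (Sum.inl j))) _
  · rw [h.invOp_pow_apply, twoSidedData_inr, twoSidedData_inr, mul_zero]

/-- The solution operator for the frequencies `ω_{j+1}`: the moment of order `j + 1` of the image
of `x` is `ω_{j+1}^{-k} x_{j+1}`. -/
def momentSolver (h : SparseFreq (twoSided ω)) (hσ : IsWindow T σ) (k : ℕ) :
    Ell2 ℕ →L[ℝ] SobolevH0 k T :=
  (h.solverH0 hσ k).comp (((2 * Complex.I ^ (k + 1)) • twoSidedData).restrictScalars ℝ)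

variable {k : ℕ}

theorem realMomentL_momentSolver (h : SparseFreq (twoSided ω)) (hσ : IsWindow T σ) (x : Ell2 ℕ)
    (j : ℕ) :
    realMomentL T (ω (j + 1)) (SobolevH0.wderiv (momentSolver h hσ k x) 0) =
      ((ω (j + 1) : ℂ) ^ k)⁻¹ * x (j + 1) := by
  have hI : (-Complex.I) ^ (k + 1) * Complex.I ^ (k + 1) = 1 := by
    rw [← mul_pow, neg_mul, Complex.I_mul_I, neg_neg, one_pow]
  refine (h.realMomentL_solverH0 hσ (l := Sum.inl j) (l' := Sum.inr j) rfl ?_).trans ?_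
  · exact mul_zero _
  · change (-Complex.I) ^ (k + 1) * (((ω (j + 1) : ℂ) ^ k)⁻¹ *
      (2 * Complex.I ^ (k + 1) * x (j + 1))) / 2 = _
    linear_combination (((ω (j + 1) : ℂ) ^ k)⁻¹ * x (j + 1)) * hI

theorem primL_volterra_pow_momentSolver (h : SparseFreq (twoSided ω)) (hσ : IsWindow T σ)
    (hT : 0 ≤ T) (x : Ell2 ℕ) {n : ℕ} (hn : n ≤ k) :
    primL T T ((volterra hT ^ n) (SobolevH0.wderiv (momentSolver h hσ k x) 0)) = 0 :=
  h.primL_volterra_pow_solverH0 hσ hT _ hn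

theorem norm_invOp_pow_momentSolver_data_le (h : SparseFreq (twoSided ω)) {p : ℕ} {x x' : Ell2 ℕ}
    (hx : ∀ j, x (j + 1) = (ω (j + 1) : ℂ) ^ p * x' (j + 1)) :
    ‖(h.invOp ^ p) ((2 * Complex.I ^ (k + 1)) • twoSidedData x)‖ ≤ 2 * ‖x'‖ := by
  rw [map_smul, invOp_pow_twoSidedData h hx, norm_smul]
  simpa using norm_twoSidedData_le x'

theorem exists_norm_wderiv_momentSolver_le (h : SparseFreq (twoSided ω)) (hσ : IsWindow T σ)
    (m : Fin (k + 1)) :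
    ∃ C : ℝ, ∀ x x' : Ell2 ℕ,
      (∀ j, x (j + 1) = (ω (j + 1) : ℂ) ^ (k - m : ℕ) * x' (j + 1)) →
      ‖SobolevH0.wderiv (momentSolver h hσ k x) m‖ ≤ C * ‖x'‖ := by
  obtain ⟨C, hC⟩ := h.exists_norm_wderiv_solverH0_le hσ m
  refine ⟨|C| * 2, fun x x' hx => (hC _).trans ?_⟩
  rw [mul_assoc]
  exact mul_le_mul (le_abs_self C) (norm_invOp_pow_momentSolver_data_le h hx) (norm_nonneg _)
    (abs_nonneg C)

theorem exists_norm_volterra_pow_momentSolver_le (h : SparseFreq (twoSided ω)) (hσ : IsWindow T σ)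
    (hT : 0 ≤ T) {n : ℕ} (hn : n ≤ k + 1) :
    ∃ C : ℝ, ∀ x x' : Ell2 ℕ, (∀ j, x (j + 1) = (ω (j + 1) : ℂ) ^ (k + n) * x' (j + 1)) →
      ‖(volterra hT ^ n) (SobolevH0.wderiv (momentSolver h hσ k x) 0)‖ ≤ C * ‖x'‖ := by
  obtain ⟨C, hC⟩ := h.exists_norm_volterra_pow_solverH0_le hσ hT hn
  refine ⟨|C| * 2, fun x x' hx => (hC _).trans ?_⟩
  rw [mul_assoc]
  exact mul_le_mul (le_abs_self C) (norm_invOp_pow_momentSolver_data_le h hx) (norm_nonneg _)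
    (abs_nonneg C)

end OneSided

section Weights

variable {ω : ℕ → ℝ} {k : ℕ} {m : ℤ}

theorem one_le_hWeight_zero (h0 : ω 0 = 0) (m : ℤ) : 1 ≤ hWeight ω m 0 := by
  rw [hWeight, if_pos rfl, h0]
  exact le_add_of_nonneg_right (zpow_nonneg le_rfl m)

theorem hWeight_succ (ω : ℕ → ℝ) (m : ℤ) (j : ℕ) : hWeight ω m (j + 1) = ω (j + 1) ^ m := by
  rw [hWeight, if_neg j.succ_ne_zero, zero_add]

namespace HSeq

/-- The sequence `((δ_{j,0} + ω_j^m) d_j)_j`, an element of `ℓ²` for all integers `m ≤ k`. -/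
def weighted (hω : StrictMono ω) (h0 : ω 0 = 0) (d : HSeq ω k) (hm : m ≤ k) : Ell2 ℕ :=
  ⟨fun j => (hWeight ω m j : ℂ) * d.seq j, memℓp_gen (by simpa using d.summable hω h0 hm)⟩

theorem norm_weighted (hω : StrictMono ω) (h0 : ω 0 = 0) (d : HSeq ω k) (hm : m ≤ k) :
    ‖d.weighted hω h0 hm‖ = hNorm ω m d.seq := by
  rw [← Real.sqrt_sq (norm_nonneg (d.weighted hω h0 hm)), ← (Ell2.hasSum_norm_sq _).tsum_eq]
  rfl

theorem toLp_succ_eq_pow_mul_weighted (hω : StrictMono ω) (h0 : ω 0 = 0) (d : HSeq ω k)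
    (hm : m ≤ k) {p : ℕ} (hp : m + p = k) (j : ℕ) :
    toLp d (j + 1) = (ω (j + 1) : ℂ) ^ p * d.weighted hω h0 hm (j + 1) := by
  have hne : ω (j + 1) ≠ 0 := (h0 ▸ hω j.succ_pos).ne'
  change (hWeight ω k (j + 1) : ℂ) * d.seq (j + 1) =
    (ω (j + 1) : ℂ) ^ p * ((hWeight ω m (j + 1) : ℂ) * d.seq (j + 1))
  rw [hWeight_succ, hWeight_succ, ← mul_assoc, ← hp, zpow_add₀ hne, zpow_natCast]
  push_cast
  ring

theorem abs_re_zero_le (hω : StrictMono ω) (h0 : ω 0 = 0) (d : HSeq ω k) (hm : m ≤ k) :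
    |(d.seq 0).re| ≤ hNorm ω m d.seq := by
  have hweight : 1 ≤ ‖(hWeight ω m 0 : ℂ)‖ := by
    rw [Complex.norm_real]
    exact (one_le_hWeight_zero h0 m).trans (le_abs_self _)
  calc |(d.seq 0).re| ≤ ‖d.seq 0‖ := Complex.abs_re_le_norm _
    _ ≤ ‖d.weighted hω h0 hm 0‖ :=
        (le_mul_of_one_le_left (norm_nonneg _) hweight).trans (norm_mul _ _).ge
    _ ≤ hNorm ω m d.seq :=
        (lp.norm_apply_le_norm two_ne_zero _ 0).trans_eq (d.norm_weighted hω h0 hm)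

/-- The coordinate `d ↦ d_0`. -/
def zeroCoord (hω : StrictMono ω) (h0 : ω 0 = 0) (k : ℕ) : HSeq ω k →L[ℝ] ℝ :=
  LinearMap.mkContinuous
    { toFun := fun d => (d.seq 0).re
      map_add' := fun _ _ => rfl
      map_smul' := fun r d => Complex.re_ofReal_mul r (d.seq 0) } 1 fun d => by
    rw [one_mul, norm_eq]
    exact d.abs_re_zero_le hω h0 le_rfl

/-- `HSeq.toLp` as a continuous map: it is isometric by the definition of the norm of `HSeq`. -/
def toLpL (ω : ℕ → ℝ) (k : ℕ) : HSeq ω k →L[ℝ] Ell2 ℕ :=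
  toLp.mkContinuous 1 fun d => (one_mul ‖d‖).ge

end HSeq

end Weights

/-! ### The zero frequency -/

section Profile

variable {T : ℝ}

theorem exists_isTestFun_integral_mul_self_eq_one (hT : 0 < T) :
    ∃ f : ℝ → ℝ, IsTestFun T f ∧ ∫ t in Ioo 0 T, f t * f t = 1 := by
  let b : ContDiffBump (T / 2) := ⟨T / 8, T / 4, by positivity, by linarith⟩
  have hsupp : tsupport b ⊆ Ioo 0 T := by
    rw [b.tsupport_eq, Real.closedBall_eq_Icc]
    exact Icc_subset_Ioo (by simp only [b]; linarith) (by simp only [b]; linarith)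
  have hb : IsTestFun T b := ⟨b.contDiff, hsupp⟩
  have hpos : 0 < ∫ t in Ioo 0 T, b t * b t := by
    rw [setIntegral_eq_integral_of_forall_compl_eq_zero
      fun t ht => by rw [hb.apply_eq_zero ht, mul_zero]]
    refine (b.continuous.mul b.continuous).integral_pos_of_hasCompactSupport_nonneg_nonzero
      b.hasCompactSupport.mul_left (fun t => mul_self_nonneg _) (x := T / 2) ?_
    simp [b.one_of_mem_closedBall (Metric.mem_closedBall_self b.rIn_pos.le)]
  set A := ∫ t in Ioo 0 T, b t * b t
  refine ⟨(√A)⁻¹ • ⇑b, hb.clm_comp ((√A)⁻¹ • ContinuousLinearMap.id ℝ ℝ), ?_⟩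
  simp only [Pi.smul_apply, smul_eq_mul, mul_mul_mul_comm _ (b _), ← mul_inv,
    Real.mul_self_sqrt hpos.le]
  rw [integral_const_mul, inv_mul_cancel₀ hpos.ne']

theorem IsTestFun.isWindow {f : ℝ → ℝ} (hf : IsTestFun T f)
    (h1 : ∫ t in Ioo 0 T, f t * f t = 1) : IsWindow T (Complex.ofRealCLM ∘ f) where
  isTestFun := hf.clm_comp _
  star_eq := funext fun t => Complex.conj_ofReal (f t)
  hat_mul_self_zero := by
    rw [← Complex.ofReal_one, ← h1, ← integral_complex_ofReal]
    simp [hat, expI]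

theorem IsTestFun.primL_toL2 (hT : 0 ≤ T) {f : ℝ → ℝ} (hf : IsTestFun T f) :
    primL T T hf.toL2 = ∫ t in Ioo 0 T, f t := by
  rw [primL_apply hT le_rfl, intervalIntegral_congr_ae_μI hT le_rfl hf.coeFn_toL2,
    intervalIntegral.integral_of_le hT, integral_Ioc_eq_integral_Ioo]

/-- A test function of mass `1` whose primitives of order `2, …, k + 1` vanish at `T`. -/
structure IsProfile (hT : 0 ≤ T) (k : ℕ) (w : ℝ → ℝ) : Prop where
  isTestFun : IsTestFun T w
  primL_eq : ∀ n ≤ k, primL T T ((volterra hT ^ n) isTestFun.toL2) = if n = 0 then 1 else 0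

theorem exists_isProfile_zero (hT : 0 < T) : ∃ w, IsProfile hT.le 0 w := by
  obtain ⟨f, hf, hf1⟩ := exists_isTestFun_integral_mul_self_eq_one hT
  refine ⟨f * f, hf.mul_contDiff hf.smooth, fun n hn => ?_⟩
  obtain rfl := Nat.le_zero.mp hn
  exact ((hf.mul_contDiff hf.smooth).primL_toL2 hT.le).trans hf1

theorem exists_isProfile (hT : 0 < T) (k : ℕ) : ∃ w, IsProfile hT.le k w := by
  induction k with
  | zero => exact exists_isProfile_zero hT
  | succ k ih =>
    obtain ⟨w, hw⟩ := ih
    obtain ⟨ψ, hψ⟩ := exists_isProfile_zero hT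
    have hprim : ∀ {q n : ℕ}, q + n = k + 1 →
        (volterra hT.le ^ n) (hψ.isTestFun.iteratedDeriv (k + 1)).toL2 =
          (hψ.isTestFun.iteratedDeriv q).toL2 := fun {q n} hqn => by
      have := (hψ.isTestFun.isTestSeries (k + 1)).volterra_pow_apply hT.le hqn.le
      rwa [hqn] at this
    -- Subtracting a multiple of `ψ^{(k+1)}` changes the primitive of order `k + 2` at `T` only.
    set c := primL T T ((volterra hT.le ^ (k + 1)) hw.isTestFun.toL2)
    have hψd := (hψ.isTestFun.iteratedDeriv (k + 1)).clm_comp ((-c) • ContinuousLinearMap.id ℝ ℝ)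
    refine ⟨_, hw.isTestFun.add hψd, fun n hn => ?_⟩
    have hadd : (hw.isTestFun.add hψd).toL2 =
      hw.isTestFun.toL2 + (-c) • (hψ.isTestFun.iteratedDeriv (k + 1)).toL2 := rfl
    rw [hadd, map_add, map_add, map_smul, map_smul]
    rcases Nat.lt_or_eq_of_le hn with hlt | rfl
    · obtain ⟨q, hq⟩ := Nat.exists_eq_add_of_lt hlt
      rw [hw.primL_eq n (by omega), hprim (q := q + 1) (by omega),
        (hψ.isTestFun.isTestSeries (q + 1)).primL_succ_eq_zero hT.le q.lt_succ_self, smul_zero,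
        add_zero]
    · have hψ1 : primL T T hψ.isTestFun.toL2 = 1 := hψ.primL_eq 0 le_rfl
      rw [hprim (zero_add _), IsTestFun.toL2_congr _ hψ.isTestFun iteratedDeriv_zero, hψ1,
        smul_eq_mul, mul_one, add_neg_cancel, if_neg k.succ_ne_zero]

theorem PowSeparated.summable_norm_hat {ω : ℕ → ℝ} (h : PowSeparated ω) (hω : StrictMono ω)
    (h0 : ω 0 = 0) {ρ : ℝ → ℂ} (hρ : IsTestFun T ρ) : Summable fun j => ‖hat T ρ (ω j)‖ := by
  obtain ⟨M, hM⟩ := h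
  obtain ⟨C, hC⟩ := hρ.exists_pow_mul_norm_hat_le M
  have hinv : Summable fun j => (|ω (j + 1)|⁻¹) ^ M := by
    simpa [Function.comp_def, h0] using hM.comp_injective
      (Function.LeftInverse.injective (f := fun j : ℕ => (j + 1, 0)) (g := fun p => p.1 - 1)
        fun j => rfl)
  rw [← summable_nat_add_iff 1]
  refine (hinv.mul_left C).of_nonneg_of_le (fun _ => norm_nonneg _) fun j => ?_
  have hpos : 0 < |ω (j + 1)| := abs_pos.mpr (h0 ▸ hω j.succ_pos).ne'
  rw [inv_pow, ← div_eq_mul_inv, le_div_iff₀' (by positivity)]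
  refine le_trans ?_ (hC (ω (j + 1)))
  gcongr
  linarith

end Profile

/-! ### The solution operator -/

section Solution

variable {ω : ℕ → ℝ} {T : ℝ} {k : ℕ}

theorem PowSeparated.memℓp_hat (h : PowSeparated ω) (hω : StrictMono ω) (h0 : ω 0 = 0)
    {ρ : ℝ → ℂ} (hρ : IsTestFun T ρ) : Memℓp (fun j => hat T ρ (ω j)) 2 :=
  (memℓp_gen (p := 1) (by simpa using h.summable_norm_hat hω h0 hρ)).of_exponent_ge one_le_two

/-- An element of `H^k_0(0, T)` that solves the moment problem for the data `d_j = δ_{j,0}` and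
whose primitives of order `2, …, k + 1` vanish at `T`. -/
structure IsUnitSolution (hT : 0 ≤ T) (ω : ℕ → ℝ) (v : SobolevH0 k T) : Prop where
  realMomentL_eq : ∀ j, realMomentL T (ω (j + 1)) (SobolevH0.wderiv v 0) = 0
  primL_eq : ∀ n ≤ k,
    primL T T ((volterra hT ^ n) (SobolevH0.wderiv v 0)) = if n = 0 then 1 else 0

theorem exists_isUnitSolution (hT : 0 < T) (hω : StrictMono ω) (h0 : ω 0 = 0)
    (h : PowSeparated ω) {σ : ℝ → ℂ} (hσ : IsWindow T σ) (k : ℕ) :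
    ∃ v : SobolevH0 k T, IsUnitSolution hT.le ω v := by
  have hs := sparseFreq_twoSided hω h0 h
  obtain ⟨w, hw⟩ := exists_isProfile hT k
  have hwC := hw.isTestFun.clm_comp Complex.ofRealCLM
  let W : SobolevH0 k T := ⟨_, (hw.isTestFun.isTestSeries k).toSobolevH_mem⟩
  have hW : SobolevH0.wderiv W 0 = hw.isTestFun.toL2 :=
    (hw.isTestFun.iteratedDeriv 0).toL2_congr hw.isTestFun iteratedDeriv_zero
  -- By the formula for the transform of a derivative, `y j = ω_j ^ k ŵ(ω_j)`.
  let y : Ell2 ℕ := (Complex.I ^ k : ℂ) • ⟨_, h.memℓp_hat hω h0 (hwC.iteratedDeriv k)⟩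
  have hy : ∀ j, y j = (ω j : ℂ) ^ k * hat T (Complex.ofRealCLM ∘ w) (ω j) := fun j => by
    change Complex.I ^ k * hat T (iteratedDeriv k _) (ω j) = _
    rw [hat_iteratedDeriv hwC, ← mul_assoc, ← mul_pow, mul_neg, ← mul_assoc, Complex.I_mul_I,
      neg_one_mul, neg_neg]
  have hsub : SobolevH0.wderiv (W - momentSolver hs hσ k y) 0 =
    SobolevH0.wderiv W 0 - SobolevH0.wderiv (momentSolver hs hσ k y) 0 := rfl
  refine ⟨W - momentSolver hs hσ k y, fun j => ?_, fun n hn => ?_⟩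
  · have hne : (ω (j + 1) : ℂ) ^ k ≠ 0 := pow_ne_zero k (hs.ofReal_ne_zero (Sum.inl j))
    rw [hsub, map_sub, hW, realMomentL_toL2, realMomentL_momentSolver, hy,
      inv_mul_cancel_left₀ hne, sub_self]
  · rw [hsub, map_sub, map_sub, hW, hw.primL_eq n hn,
      primL_volterra_pow_momentSolver hs hσ hT.le y hn, sub_zero]

/-- The solution operator: `momentSolver` takes care of the frequencies `ω_{j+1}` and leaves the
moment of frequency `0` equal to `0`, which is then corrected by a multiple of `v`. -/
def solution (hω : StrictMono ω) (h0 : ω 0 = 0) (hs : SparseFreq (twoSided ω)) {σ : ℝ → ℂ}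
    (hσ : IsWindow T σ) (v : SobolevH0 k T) : HSeq ω k →L[ℝ] SobolevH0 k T :=
  (momentSolver hs hσ k).comp (HSeq.toLpL ω k) + (HSeq.zeroCoord hω h0 k).smulRight v

variable {hω : StrictMono ω} {h0 : ω 0 = 0} {hs : SparseFreq (twoSided ω)} {σ : ℝ → ℂ}
  {hσ : IsWindow T σ} {v : SobolevH0 k T}

theorem wderiv_solution (d : HSeq ω k) (n : Fin (k + 1)) :
    SobolevH0.wderiv (solution hω h0 hs hσ v d) n =
      SobolevH0.wderiv (momentSolver hs hσ k (HSeq.toLp d)) n +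
        (d.seq 0).re • SobolevH0.wderiv v n := rfl

theorem primL_volterra_pow_solution {hT : 0 ≤ T} (hv : IsUnitSolution hT ω v) (d : HSeq ω k)
    {n : ℕ} (hn : n ≤ k) :
    primL T T ((volterra hT ^ n) (SobolevH0.wderiv (solution hω h0 hs hσ v d) 0)) =
      if n = 0 then (d.seq 0).re else 0 := by
  rw [wderiv_solution, map_add, map_add, map_smul, map_smul,
    primL_volterra_pow_momentSolver hs hσ hT _ hn, hv.primL_eq n hn, zero_add, smul_eq_mul,
    mul_ite, mul_one, mul_zero]

theorem realMomentL_solution {hT : 0 ≤ T} (hv : IsUnitSolution hT ω v) (d : HSeq ω k) (j : ℕ) :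
    realMomentL T (ω j) (SobolevH0.wderiv (solution hω h0 hs hσ v d) 0) = d.seq j := by
  rcases j with _ | j
  · have hprim := primL_volterra_pow_solution (hω := hω) (h0 := h0) (hs := hs) (hσ := hσ) hv d
      k.zero_le
    rw [if_pos rfl] at hprim
    rw [h0, realMomentL_zero hT]
    exact (congrArg _ hprim).trans (Complex.ext rfl d.seq_mem.1.symm)
  · have hne : (ω (j + 1) : ℂ) ^ k ≠ 0 := pow_ne_zero k (hs.ofReal_ne_zero (Sum.inl j))
    have htoLp : HSeq.toLp d (j + 1) = (ω (j + 1) : ℂ) ^ k * d.seq (j + 1) := by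
      change (hWeight ω k (j + 1) : ℂ) * d.seq (j + 1) = _
      rw [hWeight_succ, zpow_natCast, Complex.ofReal_pow]
    rw [wderiv_solution, map_add, map_smul, hv.realMomentL_eq, smul_zero, add_zero,
      realMomentL_momentSolver, htoLp, inv_mul_cancel_left₀ hne]

theorem intervalIntegral_solution {hT : 0 ≤ T} (hv : IsUnitSolution hT ω v) (d : HSeq ω k)
    (j : ℕ) :
    ∫ t in (0 : ℝ)..T, ((SobolevH0.toFun (solution hω h0 hs hσ v d) t : ℝ) : ℂ) *
      Complex.exp (Complex.I * (ω j : ℂ) * (t : ℂ)) = d.seq j := by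
  rw [← realMomentL_solution hv d j, realMomentL_apply, intervalIntegral.integral_of_le hT,
    integral_Ioc_eq_integral_Ioo]
  rfl

theorem iterPrim_solution_eq_zero {hT : 0 ≤ T} (hv : IsUnitSolution hT ω v) (d : HSeq ω k)
    {n : ℕ} (hn : 2 ≤ n) (hnk : n ≤ k + 1) :
    iterPrim (SobolevH0.toFun (solution hω h0 hs hσ v d)) n T = 0 := by
  obtain ⟨n, rfl⟩ := Nat.exists_eq_add_of_le' hn
  exact (iterPrim_succ_apply hT _ (n + 1)).trans
    ((primL_volterra_pow_solution hv d (by omega)).trans (if_neg n.succ_ne_zero))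

theorem eventually_posNorm_solution_le (m : Fin (k + 1)) :
    ∀ᶠ C in atTop, ∀ d : HSeq ω k,
      SobolevH0.posNorm (solution hω h0 hs hσ v d) m ≤ C * hNorm ω (m : ℕ) d.seq := by
  obtain ⟨C, hC⟩ := exists_norm_wderiv_momentSolver_le hs hσ m
  filter_upwards [eventually_ge_atTop (C + ‖SobolevH0.wderiv v m‖)] with C' hC' d
  have hm : ((m : ℕ) : ℤ) ≤ k := by omega
  have hsolver : ‖SobolevH0.wderiv (momentSolver hs hσ k (HSeq.toLp d)) m‖ ≤
      C * hNorm ω (m : ℕ) d.seq := by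
    rw [← d.norm_weighted hω h0 hm]
    exact hC _ _ (d.toLp_succ_eq_pow_mul_weighted hω h0 hm (by omega))
  calc SobolevH0.posNorm (solution hω h0 hs hσ v d) m
      ≤ C * hNorm ω (m : ℕ) d.seq + hNorm ω (m : ℕ) d.seq * ‖SobolevH0.wderiv v m‖ := by
        rw [SobolevH0.posNorm, wderiv_solution]
        refine (norm_add_le _ _).trans (add_le_add hsolver ((norm_smul_le _ _).trans ?_))
        gcongr
        exact d.abs_re_zero_le hω h0 hm
    _ = (C + ‖SobolevH0.wderiv v m‖) * hNorm ω (m : ℕ) d.seq := by ring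
    _ ≤ C' * hNorm ω (m : ℕ) d.seq := mul_le_mul_of_nonneg_right hC' (Real.sqrt_nonneg _)

theorem eventually_negNorm_solution_le {hT : 0 ≤ T} (hv : IsUnitSolution hT ω v) {n : ℕ}
    (hn : n ≤ k + 1) :
    ∀ᶠ C in atTop, ∀ d : HSeq ω k,
      negNorm T n (SobolevH0.toFun (solution hω h0 hs hσ v d)) ≤ C * hNorm ω (-(n : ℤ)) d.seq := by
  obtain ⟨C, hC⟩ := exists_norm_volterra_pow_momentSolver_le hs hσ hT hn
  set V := (volterra hT ^ n) (SobolevH0.wderiv v 0)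
  filter_upwards [eventually_ge_atTop (1 + (C + ‖V‖))] with C' hC' d
  set B := hNorm ω (-(n : ℤ)) d.seq with hB
  have hm : -(n : ℤ) ≤ k := by omega
  have hzero : |(d.seq 0).re| ≤ B := d.abs_re_zero_le hω h0 hm
  have hsolver :
      ‖(volterra hT ^ n) (SobolevH0.wderiv (momentSolver hs hσ k (HSeq.toLp d)) 0)‖ ≤ C * B := by
    rw [hB, ← d.norm_weighted hω h0 hm]
    exact hC _ _ (d.toLp_succ_eq_pow_mul_weighted hω h0 hm (by push_cast; ring))
  have hprim : primL T T (SobolevH0.wderiv (solution hω h0 hs hσ v d) 0) = (d.seq 0).re :=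
    primL_volterra_pow_solution hv d k.zero_le
  have hnorm : ‖(volterra hT ^ n) (SobolevH0.wderiv (solution hω h0 hs hσ v d) 0)‖ ≤
      C * B + B * ‖V‖ := by
    rw [wderiv_solution, map_add, map_smul]
    refine (norm_add_le _ _).trans (add_le_add hsolver ((norm_smul_le _ _).trans ?_))
    gcongr
    exact hzero
  calc negNorm T n (SobolevH0.toFun (solution hω h0 hs hσ v d))
      ≤ B + (C * B + B * ‖V‖) :=
        (negNorm_eq hT _ n).trans_le (add_le_add ((congrArg abs hprim).trans_le hzero) hnorm)
    _ = (1 + (C + ‖V‖)) * B := by ring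
    _ ≤ C' * B := mul_le_mul_of_nonneg_right hC' (Real.sqrt_nonneg _)

end Solution

end MomentProblem

end

open MomentProblem in
theorem theorem3p9_general (T : ℝ) (hT : 0 < T) (k : ℕ) (ω : ℕ → ℝ) (hω : StrictMono ω)
    (hω0 : ω 0 = 0) (hsep : PowSeparated ω) :
    ∃ C : ℝ, 0 < C ∧ ∃ M : HSeq ω k →L[ℝ] SobolevH0 k T, ∀ d : HSeq ω k,
      (∀ j : ℕ, ∫ t in (0 : ℝ)..T, ((SobolevH0.toFun (M d) t : ℝ) : ℂ) *
        Complex.exp (Complex.I * (ω j : ℂ) * (t : ℂ)) = d.seq j) ∧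
      (∀ n : ℕ, 2 ≤ n → n ≤ k + 1 → iterPrim (SobolevH0.toFun (M d)) n T = 0) ∧
      (∀ m : Fin (k + 1), SobolevH0.posNorm (M d) m ≤ C * hNorm ω ((m : ℕ) : ℤ) d.seq) ∧
      (∀ n : ℕ, 1 ≤ n → n ≤ k + 1 →
        negNorm T n (SobolevH0.toFun (M d)) ≤ C * hNorm ω (-(n : ℤ)) d.seq) := by
  obtain ⟨f, hf, hf1⟩ := exists_isTestFun_integral_mul_self_eq_one hT
  have hσ := hf.isWindow hf1
  have hs := sparseFreq_twoSided hω hω0 hsep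
  obtain ⟨v, hv⟩ := exists_isUnitSolution hT hω hω0 hsep hσ k
  let M := solution hω hω0 hs hσ v
  have hpos : ∀ᶠ C in Filter.atTop, ∀ (m : Fin (k + 1)) (d : HSeq ω k),
      SobolevH0.posNorm (M d) m ≤ C * hNorm ω ((m : ℕ) : ℤ) d.seq :=
    Filter.eventually_all.mpr eventually_posNorm_solution_le
  have hneg : ∀ᶠ C in Filter.atTop, ∀ n ∈ Iic (k + 1), ∀ d : HSeq ω k,
      negNorm T n (SobolevH0.toFun (M d)) ≤ C * hNorm ω (-(n : ℤ)) d.seq :=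
    (Filter.eventually_all_finite (finite_Iic _)).mpr fun _ hn =>
      eventually_negNorm_solution_le hv hn
  obtain ⟨C, ⟨hC, hCpos⟩, hCneg⟩ := ((Filter.eventually_gt_atTop 0).and hpos).and hneg |>.exists
  exact ⟨C, hC, M, fun d => ⟨intervalIntegral_solution hv d,
    fun _ => iterPrim_solution_eq_zero hv d, fun m => hCpos m d, fun n _ hn => hCneg n hn d⟩⟩

theorem theorem3p9 (T : ℝ) (hT : 0 < T) (k : ℕ) (hk : 1 ≤ k)
    (ω : ℕ → ℝ) (hω : StrictMono ω) (hω0 : ω 0 = 0) (hgap : MomentProblem.AsymptGapPoly ω) :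
    ∃ C : ℝ, 0 < C ∧
    ∃ M : MomentProblem.HSeq ω k →L[ℝ] MomentProblem.SobolevH0 k T,
    ∀ d : MomentProblem.HSeq ω k,
      -- the moment problem
      (∀ j : ℕ, ∫ t in (0 : ℝ)..T,
        ((MomentProblem.SobolevH0.toFun (M d) t : ℝ) : ℂ) *
          Complex.exp (Complex.I * (ω j : ℂ) * (t : ℂ)) = d.seq j) ∧
      -- the boundary conditions
      (∀ n : ℕ, 2 ≤ n → n ≤ k + 1 → MomentProblem.iterPrim (MomentProblem.SobolevH0.toFun (M d)) n T = 0) ∧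
      -- the estimates of order `0 ≤ m ≤ k`
      (∀ m : Fin (k + 1),
        MomentProblem.SobolevH0.posNorm (M d) m ≤ C * MomentProblem.hNorm ω ((m : ℕ) : ℤ) d.seq) ∧
      -- the estimates of order `-n`, `1 ≤ n ≤ k + 1`
      (∀ n : ℕ, 1 ≤ n → n ≤ k + 1 →
        MomentProblem.negNorm T n (MomentProblem.SobolevH0.toFun (M d)) ≤ C * MomentProblem.hNorm ω (-(n : ℤ)) d.seq) :=
  theorem3p9_general T hT k ω hω hω0 (hgap.powSeparated hω)
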